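/- Let $d\ge 3$. Consider two reservoirs $r=I,II$ of free spinless fermions in $\mathbb R^d$ with one-particle energy $|k|^2$ ($\hbar=1$), inverse temperatures $\beta^r>0$ and chemical potentials $\mu^r\in\mathbb R$. Let $\mathfrak F$ be the CAR algebra generated by the annihilation operators $a(f)$, $f\in L^2(\mathbb R^d)\oplus L^2(\mathbb R^d)$ (momentum representation). Let $\alpha^r_t$ be the free evolution of reservoir $r$, $\alpha^r_t(a^*(k,r))=e^{it|k|^2}a^*(k,r)$; let $\varphi^r_s$ be its gauge transformations, $\varphi^r_s(a^*(k,r))=e^{is}a^*(k,r)$ (both leave the other reservoir fixed); and put $\alpha^0_t=\alpha^I_t\alpha^{II}_t$. Let $\omega^0$ be the product of the two equilibrium states, i.e. the gauge-invariant quasi-free state with $\omega^0(a^*(k,r)a(l,s))=\delta_{rs}\,\delta(k-l)\,\rho_r(k)$, where $\rho_r(k)=(e^{\beta^r(|k|^2-\mu^r)}+1)^{-1}$. The reservoirs are coupled by a tunnelling interaction $W=g\sum_{N\ge1}\xi^N W_N$, $W_N\in\mathfrak F$, where $W_1=W_1^*$ is the one-body operator $$W_1=\sum_{r,r'}\int\!\!\int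 dk\,dl\;a^*(k,r)\,\widehat w_1((-k,r),(l,r'))\,a(l,r'),$$ $$\widehat w_1((k,r),(l,r'))=(2\pi)^{-d}\int\!\!\int dx\,dy\;e^{-i(k\cdot x+l\cdot y)}\,w_1((x,r),(y,r')).$$ Here the functions $w_1((\cdot,r),(\cdot,r'))$ and their first-order weak derivatives are in $L^1\cap L^2(\mathbb R^{2d})$, and the one-particle operator with kernel $\widehat w_1((-k,r),(l,r'))$ is trace class, so that $W_1=\sum_n a^*(f_n)a(g_n)$ for an expansion $\sum_n f_n\otimes\overline{g_n}$ of this kernel with $\sum_n\|f_n\|\|g_n\|<\infty$. Let $\omega_{\rm stat}=\omega^0\circ\sigma_+$, where $\sigma_+$ is given by its Dyson series $$\sigma_+(x)=\sum_{m\ge0}i^m\int_{0<t_1<\dots<t_m}dt_1\cdots dt_m\,[W(t_m),\dots,[W(t_1),x]\dots],\qquad W(t)=\alpha^0_{-t}(W).$$ Let $\mathcal P^r_{k,l}$, $\mathcal J^r_{k,l}$ be the terms of order $g^k\xi^l$ of the energy and particle gain per unit time of reservoir $r$, $$\mathcal P^r=-\tfrac{d}{ds}\,\omega_{\rm stat}(\alpha^r_s(W))\big|_{s=0},\qquad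 \mathcal J^r=-\tfrac{d}{ds}\,\omega_{\rm stat}(\varphi^r_s(W))\big|_{s=0},$$ and let $\mathcal E_{k,l}=\sum_{r}\beta^r\,(\mathcal P^r_{k,l}-\mu^r\mathcal J^r_{k,l})$ be the corresponding term of the entropy production rate. Put $\mathcal P=\mathcal P^I$, $\mathcal J=\mathcal J^I$ and $x^r=x^r(k)=\beta^r(|k|^2-\mu^r)$. Then the terms of order $g^2\xi^2$ of all these currents are well defined: for $\gamma=\alpha^r$ or $\varphi^r$ and all $s$, the function $t\mapsto\omega^0([\alpha^0_{-t}(W_1),\gamma_s(W_1)])$ is integrable on $(0,\infty)$, and the order-$g^2\xi^2$ term of $\omega_{\rm stat}(\gamma_s(W))$ is differentiable at $s=0$. Moreover: 1. $\mathcal E_{1,1}=\mathcal E_{1,2}=0$ and $\mathcal E_{2,2}=(\beta^I-\beta^{II})\,\mathcal P_{2,2}-(\beta^I\mu^I-\beta^{II}\mu^{II})\,\mathcal J_{2,2}$. 2. $$\mathcal E_{2,2}=2\pi\int_{\mathbb R^{d}}dk\int_{\mathbb R^d}dl\;\delta(|k|^2-|l|^2)\,\bigl|\widehat w_1((-k,II),(l,I))\bigr|^2\,\frac{(x^I-x^{II})(e^{x^I}-e^{x^{II}})}{(e^{x^I}+1)(e^{x^{II}}+1)},$$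 with an integrable integrand and a non-negative fraction. Here $\int dl\,\delta(|k|^2-|l|^2)h(l)=\tfrac12|k|^{d-2}\int_{S^{d-1}}h(|k|\sigma)\,d\sigma$. 3. If the on-shell weight $\int dl\,\delta(|k|^2-|l|^2)\,|\widehat w_1((-k,II),(l,I))|^2$ does not vanish for all $k\in\mathbb R^d$, then $\mathcal E_{2,2}>0$ unless $(\beta^I,\mu^I)=(\beta^{II},\mu^{II})$. If $(\beta^I,\mu^I)=(\beta^{II},\mu^{II})$, then $\mathcal E_{2,2}=0$. -/

import Mathlib

open MeasureTheory

noncomputable section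

namespace Tunnelling

/-- The labels of the two reservoirs. -/
inductive Reservoir
  | I
  | II
  deriving DecidableEq

instance : Fintype Reservoir := ⟨{Reservoir.I, Reservoir.II}, fun r => by cases r <;> decide⟩

/-- Euclidean `d`-space: positions, and momenta. -/
abbrev Space (d : ℕ) := EuclideanSpace ℝ (Fin d)

/-- The one-particle space of the two reservoirs in momentum representation,
`L²(ℝᵈ) ⊕ L²(ℝᵈ)`; `f r k` is the amplitude at momentum `k` in reservoir `r`. -/
abbrev OneParticle (d : ℕ) :=
  PiLp 2 (fun _ : Reservoir => Lp ℂ 2 (volume : Measure (Space d)))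

theorem memLp_phase {d : ℕ} (θ : ℝ → ℝ) (hθ : Continuous θ) (f : Lp ℂ 2 (volume : Measure (Space d))) :
    MemLp (fun k : Space d => Complex.exp (Complex.I * (θ ‖k‖ : ℂ)) * f k) 2 volume := by
  refine (Lp.memLp f).of_le ?_ (Filter.Eventually.of_forall fun k => ?_)
  · exact (by fun_prop : Continuous fun k : Space d =>
      Complex.exp (Complex.I * (θ ‖k‖ : ℂ))).aestronglyMeasurable.mul (Lp.aestronglyMeasurable f)
  · rw [norm_mul, mul_comm Complex.I, Complex.norm_exp_ofReal_mul_I, one_mul]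

/-- Multiplication of the component of `f` in reservoir `r` by the phase `exp (i θ(|k|))`; the
component in the other reservoir is unchanged. -/
def phase {d : ℕ} (r : Reservoir) (θ : ℝ → ℝ) (hθ : Continuous θ) (f : OneParticle d) :
    OneParticle d :=
  WithLp.toLp 2 fun r' => if r' = r then (memLp_phase θ hθ (f r)).toLp _ else f r'

/-- The field algebra of the two reservoirs: `𝔄` is a `C*`-algebra generated by annihilation
operators `a(f)` that are antilinear in `f` and satisfy the canonical anticommutation relations.
This determines `𝔄` up to a unique isomorphism; `star (a f)` is the creation operator `a*(f)`. -/
structure FieldAlgebra (d : ℕ) (𝔄 : Type*) [CStarAlgebra 𝔄] where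
  a : OneParticle d →ₗ⋆[ℂ] 𝔄
  anticomm : ∀ f g, a f * a g + a g * a f = 0
  anticomm_star : ∀ f g, a f * star (a g) + star (a g) * a f = (inner ℂ f g : ℂ) • (1 : 𝔄)
  generates : (StarAlgebra.adjoin ℂ (Set.range a)).topologicalClosure = ⊤

section Algebra

variable {d : ℕ} {𝔄 : Type*} [CStarAlgebra 𝔄]

/-- `α r t` is the free time evolution `e^{itHʳ} (·) e^{-itHʳ}` of reservoir `r`, where
`Hʳ = ∫ |k|² a*(k,r) a(k,r) dk`: it multiplies `a*(k,r)` by `e^{it|k|²}`. -/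
def IsFreeEvolution (F : FieldAlgebra d 𝔄) (α : Reservoir → ℝ → 𝔄 →⋆ₐ[ℂ] 𝔄) : Prop :=
  ∀ r t f, α r t (F.a f) = F.a (phase r (fun κ => t * κ ^ 2) (by fun_prop) f)

/-- `φ r s` is the gauge transformation `e^{isNʳ} (·) e^{-isNʳ}` of reservoir `r`, where
`Nʳ = ∫ a*(k,r) a(k,r) dk`: it multiplies `a*(k,r)` by `e^{is}`. -/
def IsGauge (F : FieldAlgebra d 𝔄) (φ : Reservoir → ℝ → 𝔄 →⋆ₐ[ℂ] 𝔄) : Prop :=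
  ∀ r s f, φ r s (F.a f) = F.a (phase r (fun _ => s) (by fun_prop) f)

/-- `x^r(k) = β^r (|k|² - μ^r)`. -/
def reducedEnergy (β μ : Reservoir → ℝ) (r : Reservoir) (k : Space d) : ℝ :=
  β r * (‖k‖ ^ 2 - μ r)

/-- The Fermi distribution `ρ_r(k)` of reservoir `r`. -/
def fermi (β μ : Reservoir → ℝ) (r : Reservoir) (k : Space d) : ℝ :=
  1 / (Real.exp (reducedEnergy β μ r k) + 1)

/-- `ω` is the product of the equilibrium states of the two free Fermi gases, with inverse
temperatures `β r` and chemical potentials `μ r`: the gauge-invariant quasi-free state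
whose two-point function is given by the Fermi distributions. -/
structure IsProductEquilibrium (F : FieldAlgebra d 𝔄) (β μ : Reservoir → ℝ) (ω : 𝔄 →L[ℂ] ℂ) :
    Prop where
  map_one : ω 1 = 1
  nonneg_re : ∀ x, 0 ≤ (ω (star x * x)).re
  im_eq_zero : ∀ x, (ω (star x * x)).im = 0
  two_point : ∀ f g, ω (star (F.a f) * F.a g) =
    ∑ r, ∫ k, (fermi β μ r k : ℂ) * f r k * (starRingEnd ℂ) (g r k)
  off_diagonal : ∀ (n m : ℕ) (f : Fin n → OneParticle d) (g : Fin m → OneParticle d), n ≠ m →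
    ω ((List.ofFn fun i => star (F.a (f i))).prod * (List.ofFn fun j => F.a (g j)).prod) = 0
  wick : ∀ (n : ℕ) (f g : Fin (n + 1) → OneParticle d),
    ω ((List.ofFn fun i => star (F.a (f i))).prod * (List.ofFn fun j => F.a (g j)).prod) =
      ∑ p : Fin (n + 1), (-1) ^ (n + (p : ℕ)) * ω (star (F.a (f 0)) * F.a (g p)) *
        ω ((List.ofFn fun i : Fin n => star (F.a (f i.succ))).prod *
          (List.ofFn fun j : Fin n => F.a (g (p.succAbove j))).prod)

/-- `[W(t_m), … [W(t_1), x] … ]`, with `W_{N_j}` at the `j`-th place and `W(t) = τ_{-t}(W)`. -/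
def nestedCommutator (τ : ℝ → 𝔄 →⋆ₐ[ℂ] 𝔄) (W : ℕ → 𝔄) (x : 𝔄) :
    (m : ℕ) → (Fin m → ℕ) → (Fin m → ℝ) → 𝔄
  | 0, _, _ => x
  | m + 1, N, t =>
      ⁅τ (-(t (Fin.last m))) (W (N (Fin.last m))),
        nestedCommutator τ W x m (fun i => N i.castSucc) (fun i => t i.castSucc)⁆

/-- The term of order `g^k ξ^l` of `ω_stat(g ∑_{N ≥ 1} ξ^N b_N)`, where `ω_stat = ω ∘ σ₊` and
`σ₊` is given by its Dyson series for the interaction `g ∑_{N ≥ 1} ξ^N W_N`,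
`σ₊(x) = ∑_m i^m ∫_{0 < t_1 < … < t_m} [W(t_m), … [W(t_1), x] … ] dt`. -/
def stationaryTerm (ω : 𝔄 →L[ℂ] ℂ) (τ : ℝ → 𝔄 →⋆ₐ[ℂ] 𝔄) (W b : ℕ → 𝔄) : ℕ → ℕ → ℂ
  | 0, _ => 0
  | m + 1, l =>
      ∑ N ∈ (Finset.Nat.antidiagonalTuple (m + 1) l).filter (fun N => ∀ i, 1 ≤ N i),
        Complex.I ^ m * ∫ t in {t : Fin m → ℝ | (∀ i, 0 < t i) ∧ StrictMono t},
          ω (nestedCommutator τ W (b (N 0)) m (Fin.tail N) t)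

/-- The free time evolution `α⁰ = α^I ⊗ α^II` of both reservoirs. -/
def freeEvolution (α : Reservoir → ℝ → 𝔄 →⋆ₐ[ℂ] 𝔄) (t : ℝ) : 𝔄 →⋆ₐ[ℂ] 𝔄 :=
  (α Reservoir.I t).comp (α Reservoir.II t)

/-- The term of order `g^k ξ^l` of `-(d/ds) ω_stat(γ_s(W))` at `s = 0`, for
`W = g ∑_{N ≥ 1} ξ^N W_N`. If `γ_s = e^{isQ} (·) e^{-isQ}` then this is the current
`ω_stat(-i[Q, W])`, the gain of `Q` per unit of time in the stationary state. -/
def currentTerm (ω : 𝔄 →L[ℂ] ℂ) (τ : ℝ → 𝔄 →⋆ₐ[ℂ] 𝔄) (W : ℕ → 𝔄) (γ : ℝ → 𝔄 →⋆ₐ[ℂ] 𝔄)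
    (k l : ℕ) : ℂ :=
  -deriv (fun s : ℝ => stationaryTerm ω τ W (fun N => γ s (W N)) k l) 0

/-- The term of order `g^k ξ^l` of the energy gain per unit of time of reservoir `r`. -/
def energyCurrent (ω : 𝔄 →L[ℂ] ℂ) (α : Reservoir → ℝ → 𝔄 →⋆ₐ[ℂ] 𝔄) (W : ℕ → 𝔄)
    (r : Reservoir) (k l : ℕ) : ℂ :=
  currentTerm ω (freeEvolution α) W (α r) k l

/-- The term of order `g^k ξ^l` of the gain of particles per unit of time of reservoir `r`. -/
def particleCurrent (ω : 𝔄 →L[ℂ] ℂ) (α φ : Reservoir → ℝ → 𝔄 →⋆ₐ[ℂ] 𝔄) (W : ℕ → 𝔄)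
    (r : Reservoir) (k l : ℕ) : ℂ :=
  currentTerm ω (freeEvolution α) W (φ r) k l

/-- The term of order `g^k ξ^l` of the entropy production rate `∑_r β^r (𝒫^r - μ^r 𝒥^r)`. -/
def entropyProduction (β μ : Reservoir → ℝ) (ω : 𝔄 →L[ℂ] ℂ)
    (α φ : Reservoir → ℝ → 𝔄 →⋆ₐ[ℂ] 𝔄) (W : ℕ → 𝔄) (k l : ℕ) : ℂ :=
  ∑ r, (β r : ℂ) * (energyCurrent ω α W r k l - (μ r : ℂ) * particleCurrent ω α φ W r k l)

/-- A one-body kernel in position space: `w r r' (x, y) = w₁((x, r), (y, r'))`. -/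
abbrev Kernel (d : ℕ) := Reservoir → Reservoir → Space d × Space d → ℂ

/-- `kernelFourier w r r' k l` is `ŵ₁((k, r), (l, r'))`. -/
def kernelFourier (w : Kernel d) (r r' : Reservoir) (k l : Space d) : ℂ :=
  (((2 * Real.pi) ^ d : ℝ) : ℂ)⁻¹ *
    ∫ z : Space d × Space d,
      Complex.exp (-Complex.I * ((inner ℝ k z.1 + inner ℝ l z.2 : ℝ) : ℂ)) * w r r' z

/-- The components of the kernel and their first-order weak derivatives are in `L¹ ∩ L²`. -/
def IsRegularKernel (w : Kernel d) : Prop :=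
  ∀ r r', MemLp (w r r') 1 volume ∧ MemLp (w r r') 2 volume ∧
    ∀ v : Space d × Space d, ∃ w' : Space d × Space d → ℂ,
      MemLp w' 1 volume ∧ MemLp w' 2 volume ∧
        ∀ ψ : Space d × Space d → ℝ, ContDiff ℝ (⊤ : ℕ∞) ψ → HasCompactSupport ψ →
          ∫ z, w r r' z * (fderiv ℝ ψ z v : ℂ) = -∫ z, w' z * (ψ z : ℂ)

/-- `W₁ = ∑_{r,r'} ∫∫ a*(k,r) ŵ₁((-k,r),(l,r')) a(l,r') dk dl`, as an element of the field algebra: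
the one-particle operator with this kernel is trace class, `∑ₙ |fₙ⟩⟨gₙ|`, and
`W₁ = ∑ₙ a*(fₙ) a(gₙ)` (which does not depend on the choice of the expansion). -/
def IsOneBodyInteraction (F : FieldAlgebra d 𝔄) (w : Kernel d) (W₁ : 𝔄) : Prop :=
  ∃ f g : ℕ → OneParticle d,
    Summable (fun n => ‖f n‖ * ‖g n‖) ∧
    (∀ r r', ∀ᵐ z : Space d × Space d,
      HasSum (fun n => f n r z.1 * (starRingEnd ℂ) (g n r' z.2))
        (kernelFourier w r r' (-z.1) z.2)) ∧
    HasSum (fun n => star (F.a (f n)) * F.a (g n)) W₁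

end Algebra

/-- `∫ δ(|k|² - |l|²) h(l) dl`: the integral of `h` over the sphere `|l| = |k|` with respect to
the surface measure, divided by the length `2|k|` of the gradient of `|l|²`. -/
def shellIntegral {d : ℕ} (k : Space d) (h : Space d → ℝ) : ℝ :=
  ‖k‖ ^ (d - 2) / 2 *
    ∫ σ : Metric.sphere (0 : Space d) 1, h (‖k‖ • (σ : Space d)) ∂(volume : Measure (Space d)).toSphere

/-- `∫ δ(|k|² - |l|²) |ŵ₁((-k,II),(l,I))|² dl`. -/
def onShellWeight {d : ℕ} (w : Kernel d) (k : Space d) : ℝ :=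
  shellIntegral k fun l => ‖kernelFourier w Reservoir.II Reservoir.I (-k) l‖ ^ 2

/-- The thermal factor `(x^I - x^II)(e^{x^I} - e^{x^II}) / ((e^{x^I} + 1)(e^{x^II} + 1))` at `k`,
where `x^r = β^r (|k|² - μ^r)`. -/
def thermalFactor {d : ℕ} (β μ : Reservoir → ℝ) (k : Space d) : ℝ :=
  ((reducedEnergy β μ Reservoir.I k - reducedEnergy β μ Reservoir.II k) *
      (Real.exp (reducedEnergy β μ Reservoir.I k) - Real.exp (reducedEnergy β μ Reservoir.II k))) /
    ((Real.exp (reducedEnergy β μ Reservoir.I k) + 1) *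
      (Real.exp (reducedEnergy β μ Reservoir.II k) + 1))

end Tunnelling

end

/-!
By the canonical anticommutation relations the commutator of two one-body operators is a one-body
operator, so the term of order `g²ξ²` of `ω_stat(γ_s(W))` is the integral over `t > 0` of
`C(t,s) - conj C(t,s)`, where `C` is a sum over pairs of reservoirs of oscillatory integrals of
`exp (i t (|l|² - |k|²))` against `ρ_r(k) |ŵ₁((-k,r),(l,r'))|²`. Integrating out one momentum by
Plancherel leaves a free Schrödinger evolution of an `L¹` kernel, which decays like `|t|^{-d/2}`:
for `d ≥ 3` this is integrable, and the assumption on the derivatives of `w₁` gives the same decay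
for the derivative in `s`. That derivative turns `C(t,0) - conj C(t,0)` into a sum `D(t) + D(-t)`,
so the time integral extends to the whole line and Fourier inversion in the energy variable
produces `2π δ(|k|² - |l|²)`.

On the energy shell the terms with `r = r'` cancel, and hermiticity of the kernel combines the
two others into a current carried by `ρ_II - ρ_I`. Weighting the energy and particle currents with
`β^I - β^II` and `β^I μ^I - β^II μ^II` turns it into `(ρ_II - ρ_I)(x^I - x^II)`, which is
non-negative since `exp` is increasing, and positive for almost every `k` unless the two
reservoirs are in the same state.
-/

namespace Tunnelling

open Filter Topology
open Complex (I)
open scoped Complex Real ComplexConjugate FourierTransform Convolution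

section Fourier

variable {V : Type*} [NormedAddCommGroup V] [InnerProductSpace ℝ V] [FiniteDimensional ℝ V]
  [MeasurableSpace V] [BorelSpace V]

theorem continuous_fourier {u : V → ℂ} (hu : Integrable u) : Continuous (𝓕 u) :=
  VectorFourier.fourierIntegral_continuous Real.continuous_fourierChar continuous_inner hu

theorem integral_mul_fourier {f g : V → ℂ} (hf : Integrable f) (hg : Integrable g) :
    ∫ ξ, g ξ * 𝓕 f ξ = ∫ x, 𝓕 g x * f x := by
  simpa [mul_comm, flip_innerₗ] using! (VectorFourier.integral_fourierIntegral_smul_eq_flip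
    (L := innerₗ V) Real.continuous_fourierChar continuous_inner hg hf).symm

theorem coeFn_fourier_toLp {u : V → ℂ} (hu : Integrable u) (hu2 : MemLp u 2) :
    ⇑(𝓕 (hu2.toLp u) : Lp ℂ 2 (volume : Measure V)) =ᵐ[volume] 𝓕 u := by
  refine ae_eq_of_integral_contDiff_smul_eq
    ((Lp.memLp (𝓕 (hu2.toLp u) : Lp ℂ 2 (volume : Measure V))).locallyIntegrable one_le_two)
    (continuous_fourier hu).locallyIntegrable fun φ hφ hφc => ?_
  let ψ : SchwartzMap V ℂ := (hφc.comp_left (g := Complex.ofReal) rfl).toSchwartzMap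
    (Complex.ofRealCLM.contDiff.comp hφ)
  have h := DFunLike.congr_fun (Lp.fourier_toTemperedDistribution_eq (hu2.toLp u)) ψ
  rw [TemperedDistribution.fourier_apply, Lp.toTemperedDistribution_apply,
    Lp.toTemperedDistribution_apply] at h
  calc ∫ ξ, φ ξ • (𝓕 (hu2.toLp u) : Lp ℂ 2 (volume : Measure V)) ξ
    _ = ∫ ξ, ψ ξ • (𝓕 (hu2.toLp u) : Lp ℂ 2 (volume : Measure V)) ξ := rfl
    _ = ∫ x, 𝓕 ψ x • (hu2.toLp u) x := h.symm
    _ = ∫ x, 𝓕 (ψ : V → ℂ) x * u x := by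
      refine integral_congr_ae ?_
      filter_upwards [hu2.coeFn_toLp] with x hx
      rw [hx, smul_eq_mul, SchwartzMap.fourier_coe]
    _ = ∫ ξ, φ ξ • 𝓕 u ξ := (integral_mul_fourier hu ψ.integrable).symm

theorem memLp_two_fourier {u : V → ℂ} (hu : Integrable u) (hu2 : MemLp u 2) : MemLp (𝓕 u) 2 :=
  (memLp_congr_ae (coeFn_fourier_toLp hu hu2)).1 (Lp.memLp _)

theorem norm_fourier_gaussian_le {b : ℂ} (hb : 0 < b.re) (w : V) :
    ‖𝓕 (fun v : V => cexp (-b * ‖v‖ ^ 2)) w‖ ≤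
      (π / ‖b‖) ^ (Module.finrank ℝ V / 2 : ℝ) := by
  rw [fourier_gaussian_innerProductSpace hb, norm_mul]
  have hconst : ‖(π / b : ℂ) ^ (Module.finrank ℝ V / 2 : ℂ)‖ =
      (π / ‖b‖) ^ (Module.finrank ℝ V / 2 : ℝ) := by
    rw [← Complex.ofReal_natCast, ← Complex.ofReal_ofNat, ← Complex.ofReal_div,
      Complex.norm_cpow_real, norm_div, Complex.norm_real, Real.norm_of_nonneg Real.pi_pos.le]
  have hexp : (-π ^ 2 * ‖w‖ ^ 2 / b : ℂ) = ((-(π ^ 2 * ‖w‖ ^ 2) : ℝ) : ℂ) * b⁻¹ := by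
    push_cast; ring
  rw [hconst, hexp, Complex.norm_exp, Complex.re_ofReal_mul, Complex.inv_re]
  refine mul_le_of_le_one_right (by positivity) (Real.exp_le_one_iff.2 ?_)
  exact mul_nonpos_of_nonpos_of_nonneg (by simp only [Left.neg_nonpos_iff]; positivity)
    (div_nonneg hb.le (Complex.normSq_nonneg b))

theorem norm_integral_gaussian_mul_fourier_le {v : V → ℂ} (hv : Integrable v) {b : ℂ}
    (hb : 0 < b.re) :
    ‖∫ ξ, cexp (-b * ‖ξ‖ ^ 2) * 𝓕 v ξ‖ ≤
      (π / ‖b‖) ^ (Module.finrank ℝ V / 2 : ℝ) * ∫ x, ‖v x‖ := by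
  have hgauss : Integrable fun ξ : V => cexp (-b * ‖ξ‖ ^ 2) := by
    simpa using GaussianFourier.integrable_cexp_neg_mul_sq_norm_add hb 0 (0 : V)
  rw [integral_mul_fourier hv hgauss, ← integral_const_mul]
  refine norm_integral_le_of_norm_le (hv.norm.const_mul _) (.of_forall fun x => ?_)
  rw [norm_mul]
  gcongr
  exact norm_fourier_gaussian_le hb x

theorem tendsto_integral_gaussian_mul {f : V → ℂ} (hf : Integrable f) (t : ℝ) :
    Tendsto (fun ε : ℝ => ∫ ξ, cexp (-(ε - t * I) * ‖ξ‖ ^ 2) * f ξ) (𝓝[>] 0)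
      (𝓝 (∫ ξ, cexp (I * (t * ‖ξ‖ ^ 2 : ℝ)) * f ξ)) := by
  refine tendsto_integral_filter_of_dominated_convergence (fun ξ => ‖f ξ‖)
    (.of_forall fun ε => ?_) ?_ hf.norm (.of_forall fun ξ => ?_)
  · exact (by fun_prop : Continuous fun ξ : V =>
      cexp (-(ε - t * I) * ‖ξ‖ ^ 2)).aestronglyMeasurable.mul hf.1
  · filter_upwards [self_mem_nhdsWithin] with ε hε
    refine .of_forall fun ξ => ?_
    have hre : (-(ε - t * I) * ‖ξ‖ ^ 2 : ℂ).re = -(ε * ‖ξ‖ ^ 2) := by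
      simp [← Complex.ofReal_pow]
    rw [norm_mul, Complex.norm_exp, hre]
    exact mul_le_of_le_one_left (norm_nonneg _)
      (Real.exp_le_one_iff.2 (neg_nonpos.2 (mul_nonneg (le_of_lt hε) (sq_nonneg _))))
  · have hcont : Continuous fun ε : ℝ => cexp (-(ε - t * I) * ‖ξ‖ ^ 2) := by
      fun_prop
    have hlim : cexp (-((0 : ℝ) - t * I) * ‖ξ‖ ^ 2) =
        cexp (I * (t * ‖ξ‖ ^ 2 : ℝ)) := by
      congr 1
      push_cast
      ring
    rw [← hlim]
    exact ((hcont.tendsto 0).mono_left nhdsWithin_le_nhds).mul_const _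

/-- Dispersive estimate: `exp (i t |ξ|²)` is the limit of Gaussians whose Fourier transforms are
bounded by `(π / |t|) ^ (dim V / 2)`. -/
theorem norm_integral_schrodinger_mul_fourier_le {v : V → ℂ} (hv : Integrable v)
    (hFv : Integrable (𝓕 v)) {t : ℝ} (ht : t ≠ 0) :
    ‖∫ ξ, cexp (I * (t * ‖ξ‖ ^ 2 : ℝ)) * 𝓕 v ξ‖ ≤
      (π / |t|) ^ (Module.finrank ℝ V / 2 : ℝ) * ∫ x, ‖v x‖ := by
  have hbound : ContinuousAt (fun ε : ℝ =>
      (π / ‖(ε - t * I : ℂ)‖) ^ (Module.finrank ℝ V / 2 : ℝ) * ∫ x, ‖v x‖) 0 :=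
    ((continuousAt_const.div (by fun_prop) (by simpa using ht)).rpow_const
      (.inr (by positivity))).mul_const _
  have hlim := hbound.tendsto.mono_left (nhdsWithin_le_nhds (s := Set.Ioi 0))
  refine le_of_tendsto_of_tendsto (tendsto_integral_gaussian_mul hFv t).norm
    (by simpa using hlim) ?_
  filter_upwards [self_mem_nhdsWithin] with ε hε
  exact norm_integral_gaussian_mul_fourier_le hv (by simpa using hε)

theorem fourier_conj_comp_neg (u : V → ℂ) (ξ : V) :
    𝓕 (fun x => conj (u (-x))) ξ = conj (𝓕 u ξ) := by
  rw [Real.fourier_eq, Real.fourier_eq, ← integral_conj, ← integral_neg_eq_self]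
  refine integral_congr_ae (.of_forall fun x => ?_)
  simp [Circle.smul_def, ← Circle.coe_inv_eq_conj, ← AddChar.map_neg_eq_inv]

theorem integral_norm_convolution_le {u v : V → ℂ} (hu : Integrable u) (hv : Integrable v) :
    ∫ x, ‖(u ⋆[ContinuousLinearMap.mul ℂ ℂ] v) x‖ ≤
      (∫ x, ‖u x‖) * ∫ x, ‖v x‖ := by
  have hnorm : Integrable ((fun x => ‖u x‖) ⋆[ContinuousLinearMap.mul ℝ ℝ] fun x => ‖v x‖) :=
    hu.norm.integrable_convolution _ hv.norm
  calc ∫ x, ‖(u ⋆[ContinuousLinearMap.mul ℂ ℂ] v) x‖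
    _ ≤ ∫ x, ((fun x => ‖u x‖) ⋆[ContinuousLinearMap.mul ℝ ℝ] fun x => ‖v x‖) x :=
        integral_mono_of_nonneg (.of_forall fun _ => norm_nonneg _) hnorm
          (.of_forall fun x => (norm_integral_le_integral_norm _).trans_eq (by simp; rfl))
    _ = _ := by rw [integral_convolution _ hu.norm hv.norm, ContinuousLinearMap.mul_apply']

/-- The Fourier transform of the autocorrelation of `u` is `|𝓕 u|²`, which reduces this to
`norm_integral_schrodinger_mul_fourier_le`. -/
theorem norm_integral_schrodinger_mul_normSq_fourier_le {u : V → ℂ} (hu : Integrable u)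
    (hFu : Integrable fun ξ => ‖𝓕 u ξ‖ ^ 2) {t : ℝ} (ht : t ≠ 0) :
    ‖∫ ξ, cexp (I * (t * ‖ξ‖ ^ 2 : ℝ)) * (‖𝓕 u ξ‖ ^ 2 : ℝ)‖ ≤
      (π / |t|) ^ (Module.finrank ℝ V / 2 : ℝ) * (∫ x, ‖u x‖) ^ 2 := by
  set u' : V → ℂ := fun x => conj (u (-x)) with hu'_def
  have hu' : Integrable u' :=
    (LinearIsometryEquiv.integrable_comp_iff Complex.conjLIE).2 hu.comp_neg
  set v : V → ℂ := u ⋆[ContinuousLinearMap.mul ℂ ℂ] u'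
  have hFv (ξ : V) : 𝓕 v ξ = (‖𝓕 u ξ‖ ^ 2 : ℝ) := by
    rw [Real.fourier_mul_convolution_eq hu hu', fourier_conj_comp_neg, Complex.mul_conj']
    norm_cast
  have hv : Integrable v := hu.integrable_convolution (ContinuousLinearMap.mul ℂ ℂ) hu'
  have hnorm : ∫ x, ‖v x‖ ≤ (∫ x, ‖u x‖) ^ 2 := by
    refine (integral_norm_convolution_le hu hu').trans_eq ?_
    simp only [hu'_def, RCLike.norm_conj, integral_neg_eq_self (fun x => ‖u x‖), sq]
  simp_rw [← hFv]
  refine (norm_integral_schrodinger_mul_fourier_le hv ?_ ht).trans (by gcongr)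
  exact hFu.ofReal.congr (.of_forall fun ξ => (hFv ξ).symm)

end Fourier

section DoubleFourier

variable {d : ℕ}

/-- The Fourier transform `(2π)⁻ᵈ ∫∫ e^{-i(k·x + l·y)} u(x,y) dx dy`, so that
`kernelFourier w r r' = doubleFourier (w r r')`. -/
noncomputable def doubleFourier (u : Space d × Space d → ℂ) (k l : Space d) : ℂ :=
  (((2 * π) ^ d : ℝ) : ℂ)⁻¹ *
    ∫ z : Space d × Space d, cexp (-I * (inner ℝ k z.1 + inner ℝ l z.2 : ℝ)) * u z

/-- The Fourier transform `y ↦ ∫ e^{-ik·x} u(x,y) dx` in the first variable. -/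
noncomputable def partialFourier (u : Space d × Space d → ℂ) (k y : Space d) : ℂ :=
  ∫ x, cexp (-I * (inner ℝ k x : ℝ)) * u (x, y)

theorem norm_exp_I_mul (x : ℝ) : ‖cexp (I * x)‖ = 1 := by
  rw [mul_comm, Complex.norm_exp_ofReal_mul_I]

theorem norm_exp_neg_I_mul (x : ℝ) : ‖cexp (-I * x)‖ = 1 := by
  simpa using norm_exp_I_mul (-x)

theorem fourier_inv_two_pi_smul {V : Type*} [NormedAddCommGroup V] [InnerProductSpace ℝ V]
    [MeasurableSpace V] [BorelSpace V] [FiniteDimensional ℝ V] (u : V → ℂ) (k : V) :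
    𝓕 u ((2 * π)⁻¹ • k) = ∫ x, cexp (-I * (inner ℝ k x : ℝ)) * u x := by
  rw [Real.fourier_eq']
  refine integral_congr_ae (.of_forall fun x => ?_)
  simp only [smul_eq_mul, inner_smul_right, real_inner_comm x k]
  congr 2
  push_cast
  field_simp

theorem integrable_exp_I_mul {X : Type*} [TopologicalSpace X] [MeasurableSpace X]
    [OpensMeasurableSpace X] {ν : Measure X} {u : X → ℂ} (hu : Integrable u ν) {θ : X → ℝ}
    (hθ : Continuous θ) : Integrable (fun x => cexp (I * θ x) * u x) ν :=
  hu.bdd_mul (c := 1) (by fun_prop) (.of_forall fun x => (norm_exp_I_mul _).le)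

theorem integrable_exp_neg_I_mul {X : Type*} [TopologicalSpace X] [MeasurableSpace X]
    [OpensMeasurableSpace X] {ν : Measure X} {u : X → ℂ} (hu : Integrable u ν) {θ : X → ℝ}
    (hθ : Continuous θ) : Integrable (fun x => cexp (-I * θ x) * u x) ν := by
  simpa using integrable_exp_I_mul hu hθ.neg

theorem doubleFourier_eq_fourier (u : Space d × Space d → ℂ) (k l : Space d) :
    doubleFourier u k l = (((2 * π) ^ d : ℝ) : ℂ)⁻¹ *
      𝓕 (u ∘ WithLp.ofLp (p := 2)) ((2 * π)⁻¹ • WithLp.toLp 2 (k, l)) := by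
  rw [doubleFourier, fourier_inv_two_pi_smul,
    ← (WithLp.volume_preserving_ofLp (Space d) (Space d)).integral_comp
      (WithLp.homeomorphProd 2 (Space d) (Space d)).measurableEmbedding]
  rfl

theorem doubleFourier_eq_fourier_partialFourier {u : Space d × Space d → ℂ} (hu : Integrable u)
    (k l : Space d) :
    doubleFourier u k l =
      (((2 * π) ^ d : ℝ) : ℂ)⁻¹ * 𝓕 (partialFourier u k) ((2 * π)⁻¹ • l) := by
  have hint : Integrable (fun z : Space d × Space d =>
      cexp (-I * (inner ℝ k z.1 + inner ℝ l z.2 : ℝ)) * u z) (volume.prod volume) :=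
    integrable_exp_neg_I_mul hu (by fun_prop)
  rw [doubleFourier, fourier_inv_two_pi_smul, Measure.volume_eq_prod, integral_prod_symm _ hint]
  simp_rw [partialFourier, ← integral_const_mul]
  congr 3 with y
  congr 1 with x
  rw [Complex.ofReal_add, mul_add, Complex.exp_add]
  ring

theorem continuous_doubleFourier {u : Space d × Space d → ℂ} (hu : Integrable u) :
    Continuous fun z : Space d × Space d => doubleFourier u z.1 z.2 := by
  have hu' : Integrable (u ∘ WithLp.ofLp (p := 2)) :=
    (WithLp.volume_preserving_ofLp (Space d) (Space d)).integrable_comp_of_integrable hu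
  simp_rw [doubleFourier_eq_fourier]
  have := continuous_fourier hu'
  fun_prop

theorem integrable_normSq_doubleFourier {u : Space d × Space d → ℂ} (hu : Integrable u)
    (hu2 : MemLp u 2) :
    Integrable fun z : Space d × Space d => ‖doubleFourier u z.1 z.2‖ ^ 2 := by
  have hmp := WithLp.volume_preserving_ofLp (Space d) (Space d)
  have hFu : MemLp (𝓕 (u ∘ WithLp.ofLp (p := 2))) 2 :=
    memLp_two_fourier (hmp.integrable_comp_of_integrable hu) (hu2.comp_measurePreserving hmp)
  have hsq := ((hFu.integrable_norm_pow two_ne_zero).comp_smul (R := (2 * π)⁻¹) (by positivity))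
  simp_rw [doubleFourier_eq_fourier, norm_mul, mul_pow]
  exact ((WithLp.volume_preserving_toLp (Space d) (Space d)).integrable_comp_of_integrable
    hsq).const_mul _

theorem integrable_partialFourier {u : Space d × Space d → ℂ} (hu : Integrable u) (k : Space d) :
    Integrable (partialFourier u k) :=
  Integrable.integral_prod_right (f := fun z : Space d × Space d =>
    cexp (-I * (inner ℝ k z.1 : ℝ)) * u z) (integrable_exp_neg_I_mul hu (by fun_prop))

theorem integral_norm_partialFourier_le {u : Space d × Space d → ℂ} (hu : Integrable u)
    (k : Space d) : ∫ y, ‖partialFourier u k y‖ ≤ ∫ z, ‖u z‖ := by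
  rw [Measure.volume_eq_prod, integral_prod_symm _ hu.norm]
  refine integral_mono (integrable_partialFourier hu k).norm
    (Integrable.integral_prod_right hu.norm) fun y => ?_
  refine (norm_integral_le_integral_norm _).trans_eq ?_
  simp_rw [norm_mul, norm_exp_neg_I_mul, one_mul]

theorem normSq_fourier_partialFourier {u : Space d × Space d → ℂ} (hu : Integrable u)
    (k ξ : Space d) : ‖𝓕 (partialFourier u k) ξ‖ ^ 2 =
      ((2 * π) ^ d) ^ 2 * ‖doubleFourier u k ((2 * π) • ξ)‖ ^ 2 := by
  rw [doubleFourier_eq_fourier_partialFourier hu, inv_smul_smul₀ (by positivity), norm_mul,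
    norm_inv, Complex.norm_real, Real.norm_of_nonneg (by positivity)]
  field_simp

theorem integral_schrodinger_mul_normSq_doubleFourier {u : Space d × Space d → ℂ}
    (hu : Integrable u) (k : Space d) (t : ℝ) :
    ∫ l, cexp (I * (t * ‖l‖ ^ 2 : ℝ)) * (‖doubleFourier u k l‖ ^ 2 : ℝ) =
      (((2 * π) ^ d)⁻¹ : ℝ) * ∫ ξ, cexp (I * (t * (2 * π) ^ 2 * ‖ξ‖ ^ 2 : ℝ)) *
        (‖𝓕 (partialFourier u k) ξ‖ ^ 2 : ℝ) := by
  have hcomp := Measure.integral_comp_smul (volume : Measure (Space d))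
    (fun l => cexp (I * (t * ‖l‖ ^ 2 : ℝ)) * (‖doubleFourier u k l‖ ^ 2 : ℝ)) (2 * π)
  have hpt (ξ : Space d) : cexp (I * (t * (2 * π) ^ 2 * ‖ξ‖ ^ 2 : ℝ)) *
      (‖𝓕 (partialFourier u k) ξ‖ ^ 2 : ℝ) = (((2 * π) ^ d) ^ 2 : ℝ) *
        (cexp (I * (t * ‖(2 * π) • ξ‖ ^ 2 : ℝ)) *
          (‖doubleFourier u k ((2 * π) • ξ)‖ ^ 2 : ℝ)) := by
    rw [normSq_fourier_partialFourier hu, norm_smul, Real.norm_of_nonneg (by positivity),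
      mul_pow (2 * π), mul_assoc t]
    push_cast
    ring
  simp_rw [hpt]
  rw [integral_const_mul, hcomp, finrank_euclideanSpace_fin, abs_of_nonneg (by positivity),
    Complex.real_smul, ← mul_assoc, ← mul_assoc, ← Complex.ofReal_mul, ← Complex.ofReal_mul]
  field_simp
  simp

theorem norm_integral_schrodinger_mul_normSq_doubleFourier_le {u : Space d × Space d → ℂ}
    (hu : Integrable u) {k : Space d} (hk : Integrable fun l => ‖doubleFourier u k l‖ ^ 2) {t : ℝ}
    (ht : t ≠ 0) :
    ‖∫ l, cexp (I * (t * ‖l‖ ^ 2 : ℝ)) * (‖doubleFourier u k l‖ ^ 2 : ℝ)‖ ≤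
      ((2 * π) ^ d)⁻¹ * ((4 * π * |t|)⁻¹ ^ (d / 2 : ℝ) * (∫ z, ‖u z‖) ^ 2) := by
  have hFint : Integrable fun ξ => ‖𝓕 (partialFourier u k) ξ‖ ^ 2 := by
    simp_rw [normSq_fourier_partialFourier hu]
    exact (hk.comp_smul (R := 2 * π) (by positivity)).const_mul _
  have h := norm_integral_schrodinger_mul_normSq_fourier_le (integrable_partialFourier hu k) hFint
    (t := t * (2 * π) ^ 2) (by positivity)
  rw [integral_schrodinger_mul_normSq_doubleFourier hu, norm_mul, Complex.norm_real,
    Real.norm_of_nonneg (by positivity)]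
  gcongr
  refine h.trans ?_
  rw [finrank_euclideanSpace_fin, abs_mul, abs_of_nonneg (a := (2 * π) ^ 2) (by positivity)]
  gcongr
  · exact le_of_eq (by field_simp; ring)
  · exact integral_norm_partialFourier_le hu k

end DoubleFourier

section WeakDerivative

open scoped ContDiff

section

variable {X : Type*} [TopologicalSpace X] [MeasurableSpace X] [OpensMeasurableSpace X]
  {μ : Measure X}

theorem tendsto_integral_mul_of_bounded {u : X → ℂ} (hu : Integrable u μ) {f : ℕ → X → ℝ}
    {g : X → ℝ} {C : ℝ} (hf : ∀ n, Continuous (f n)) (hC : ∀ n z, ‖f n z‖ ≤ C)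
    (hlim : ∀ z, Tendsto (f · z) atTop (𝓝 (g z))) :
    Tendsto (fun n => ∫ z, u z * (f n z : ℂ) ∂μ) atTop (𝓝 (∫ z, u z * (g z : ℂ) ∂μ)) := by
  refine tendsto_integral_of_dominated_convergence (fun z => ‖u z‖ * C)
    (fun n => hu.1.mul (Complex.continuous_ofReal.comp (hf n)).aestronglyMeasurable)
    (hu.norm.mul_const _) (fun n => .of_forall fun z => ?_) (.of_forall fun z => ?_)
  · rw [norm_mul, Complex.norm_real]
    gcongr
    exact hC n z
  · exact ((Complex.continuous_ofReal.tendsto _).comp (hlim z)).const_mul _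

theorem integral_mul_eq_re_add_im {u f : X → ℂ} (hu : Integrable u μ) (hf : Continuous f) {C : ℝ}
    (hC : ∀ z, ‖f z‖ ≤ C) :
    ∫ z, u z * f z ∂μ =
      (∫ z, u z * ((f z).re : ℂ) ∂μ) + I * ∫ z, u z * ((f z).im : ℂ) ∂μ := by
  have hre : Integrable (fun z => u z * ((f z).re : ℂ)) μ :=
    hu.mul_bdd (c := C) (by fun_prop) (.of_forall fun z => by
      simpa using (Complex.abs_re_le_norm _).trans (hC z))
  have him : Integrable (fun z => u z * ((f z).im : ℂ)) μ :=
    hu.mul_bdd (c := C) (by fun_prop) (.of_forall fun z => by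
      simpa using (Complex.abs_im_le_norm _).trans (hC z))
  rw [← integral_const_mul, ← integral_add hre (him.const_mul I)]
  refine integral_congr_ae (.of_forall fun z => ?_)
  calc u z * f z = u z * ((f z).re + (f z).im * I) := by rw [Complex.re_add_im]
    _ = u z * (f z).re + I * (u z * (f z).im) := by ring

end

variable {E : Type*} [NormedAddCommGroup E] [NormedSpace ℝ E] [FiniteDimensional ℝ E]

theorem exists_smooth_cutoff : ∃ (χ : ℕ → E → ℝ) (C : ℝ),
    (∀ n, ContDiff ℝ ∞ (χ n)) ∧ (∀ n, HasCompactSupport (χ n)) ∧ (∀ n z, ‖χ n z‖ ≤ 1) ∧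
      (∀ n z, ‖fderiv ℝ (χ n) z‖ ≤ C) ∧ ∀ z, ∀ᶠ n in atTop, χ n =ᶠ[𝓝 z] 1 := by
  let χ : ContDiffBump (0 : E) := ⟨1, 2, one_pos, one_lt_two⟩
  have hχ : ContDiff ℝ ∞ χ := χ.contDiff
  obtain ⟨C, hC⟩ := (χ.hasCompactSupport.fderiv (𝕜 := ℝ)).exists_bound_of_continuous
    (hχ.continuous_fderiv (by simp))
  refine ⟨fun n z => χ ((n + 1 : ℝ)⁻¹ • z), C, fun n => hχ.comp (contDiff_const_smul _),
    fun n => χ.hasCompactSupport.comp_smul (by positivity),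
    fun n z => (Real.norm_of_nonneg χ.nonneg).trans_le χ.le_one, fun n z => ?_, fun z => ?_⟩
  · rw [fderiv_comp_smul, norm_smul, Real.norm_of_nonneg (by positivity)]
    exact (mul_le_of_le_one_left (norm_nonneg _) (inv_le_one_of_one_le₀ (by simp))).trans (hC _)
  · filter_upwards [eventually_gt_atTop ⌈‖z‖⌉₊] with n hn
    have hz : ‖z‖ < n + 1 := (Nat.lt_of_ceil_lt hn).trans (lt_add_one _)
    filter_upwards [(continuous_norm.tendsto z).eventually_lt_const hz] with y hy
    refine χ.one_of_mem_closedBall (mem_closedBall_zero_iff.2 ?_)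
    rw [norm_smul, Real.norm_of_nonneg (by positivity)]
    exact inv_mul_le_one_of_le₀ hy.le (by positivity)

variable [MeasurableSpace E] [BorelSpace E] {μ : Measure E}

/-- `u'` is the weak derivative of `u` in the direction `v`. -/
def IsWeakDeriv (μ : Measure E) (u u' : E → ℂ) (v : E) : Prop :=
  ∀ ψ : E → ℝ, ContDiff ℝ ∞ ψ → HasCompactSupport ψ →
    ∫ z, u z * (fderiv ℝ ψ z v : ℂ) ∂μ = -∫ z, u' z * (ψ z : ℂ) ∂μ

theorem IsWeakDeriv.integral_mul_fderiv {u u' : E → ℂ} {v : E} (h : IsWeakDeriv μ u u' v)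
    (hu : Integrable u μ) (hu' : Integrable u' μ) {f : E → ℝ} (hf : ContDiff ℝ ∞ f) {C C' : ℝ}
    (hC : ∀ z, ‖f z‖ ≤ C) (hC' : ∀ z, ‖fderiv ℝ f z‖ ≤ C') :
    ∫ z, u z * (fderiv ℝ f z v : ℂ) ∂μ = -∫ z, u' z * (f z : ℂ) ∂μ := by
  obtain ⟨χ, B, hχ, hχc, hχ1, hB, hlim⟩ := exists_smooth_cutoff (E := E)
  have hψ (n : ℕ) : ContDiff ℝ ∞ (χ n * f) := (hχ n).mul hf
  have hfderiv (n : ℕ) (z : E) :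
      fderiv ℝ (χ n * f) z = χ n z • fderiv ℝ f z + f z • fderiv ℝ (χ n) z :=
    fderiv_mul ((hχ n).differentiable (by simp) z) (hf.differentiable (by simp) z)
  have hleft := tendsto_integral_mul_of_bounded hu (f := fun n z => fderiv ℝ (χ n * f) z v)
    (g := fun z => fderiv ℝ f z v) (C := (1 * C' + C * B) * ‖v‖)
    (fun n => ((hψ n).continuous_fderiv (by simp)).clm_apply continuous_const)
    (fun n z => ?_) fun z => ?_
  · have hright := tendsto_integral_mul_of_bounded hu' (f := fun n => χ n * f) (g := f)
      (C := 1 * C) (fun n => (hψ n).continuous) (fun n z => ?_) fun z => ?_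
    · exact tendsto_nhds_unique hleft (hright.neg.congr fun n =>
        (h _ (hψ n) (hχc n).mul_right).symm)
    · exact (norm_mul_le _ _).trans (by gcongr; exacts [hχ1 n z, hC z])
    · refine tendsto_const_nhds.congr' ?_
      filter_upwards [hlim z] with n hn
      simp [hn.eq_of_nhds]
  · refine (ContinuousLinearMap.le_opNorm _ _).trans ?_
    rw [hfderiv]
    gcongr
    refine (norm_add_le _ _).trans ?_
    rw [norm_smul, norm_smul]
    have hC0 := (norm_nonneg _).trans (hC z)
    gcongr
    exacts [hχ1 n z, hC' z, hC z, hB n z]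
  · refine tendsto_const_nhds.congr' ?_
    filter_upwards [hlim z] with n hn
    simp [hfderiv, hn.fderiv_eq, hn.eq_of_nhds, Pi.one_def]

theorem IsWeakDeriv.integral_mul_fderiv_complex {u u' : E → ℂ} {v : E} (h : IsWeakDeriv μ u u' v)
    (hu : Integrable u μ) (hu' : Integrable u' μ) {f : E → ℂ} (hf : ContDiff ℝ ∞ f) {C C' : ℝ}
    (hC : ∀ z, ‖f z‖ ≤ C) (hC' : ∀ z, ‖fderiv ℝ f z‖ ≤ C') :
    ∫ z, u z * fderiv ℝ f z v ∂μ = -∫ z, u' z * f z ∂μ := by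
  have hpart (L : ℂ →L[ℝ] ℝ) (hL : ‖L‖ ≤ 1) :
      ∫ z, u z * (L (fderiv ℝ f z v) : ℂ) ∂μ = -∫ z, u' z * (L (f z) : ℂ) ∂μ := by
    have hfderiv (z : E) : fderiv ℝ (L ∘ f) z = L.comp (fderiv ℝ f z) :=
      L.hasFDerivAt.comp z (hf.differentiable (by simp) z).hasFDerivAt |>.fderiv
    have hcomp := h.integral_mul_fderiv hu hu' (L.contDiff.comp hf) (C := 1 * C) (C' := 1 * C')
      (fun z => (L.le_opNorm _).trans (by gcongr; exact hC z)) fun z => by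
        rw [hfderiv]
        exact (L.opNorm_comp_le _).trans (by gcongr; exact hC' z)
    simpa only [hfderiv] using! hcomp
  rw [integral_mul_eq_re_add_im hu' hf.continuous hC, integral_mul_eq_re_add_im hu
    ((hf.continuous_fderiv (by simp)).clm_apply continuous_const)
    (fun z => (ContinuousLinearMap.le_opNorm _ _).trans
      (mul_le_mul_of_nonneg_right (hC' z) (norm_nonneg v)))]
  have hre := hpart Complex.reCLM Complex.reCLM_norm.le
  have him := hpart Complex.imCLM Complex.imCLM_norm.le
  simp only [Complex.reCLM_apply, Complex.imCLM_apply] at hre him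
  rw [hre, him]
  ring

/-- The plane wave `e^{-i(k·x + l·y)}` is an admissible test function because `u` and `u'` are
integrable. -/
theorem IsWeakDeriv.doubleFourier_eq {d : ℕ} {u u' : Space d × Space d → ℂ}
    {v : Space d × Space d} (h : IsWeakDeriv volume u u' v) (hu : Integrable u)
    (hu' : Integrable u') (k l : Space d) :
    doubleFourier u' k l = I * (inner ℝ k v.1 + inner ℝ l v.2 : ℝ) * doubleFourier u k l := by
  let A : Space d × Space d →L[ℝ] ℝ := (innerSL ℝ k).coprod (innerSL ℝ l)
  let L : Space d × Space d →L[ℝ] ℂ := -I • Complex.ofRealCLM.comp A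
  have hderiv (z : Space d × Space d) :
      HasFDerivAt (fun z => cexp (L z)) (cexp (L z) • L) z := L.hasFDerivAt.cexp
  have hnorm (z : Space d × Space d) : ‖cexp (L z)‖ = 1 := norm_exp_neg_I_mul (A z)
  have hparts : ∫ z, u z * (cexp (L z) * L v) = -∫ z, u' z * cexp (L z) := by
    simpa only [(hderiv _).fderiv] using! h.integral_mul_fderiv_complex hu hu' L.contDiff.cexp
      (fun z => (hnorm z).le) (C' := ‖L‖) fun z => by
        rw [(hderiv z).fderiv, norm_smul, hnorm, one_mul]
  have hfourier (u : Space d × Space d → ℂ) :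
      doubleFourier u k l = (((2 * π) ^ d : ℝ) : ℂ)⁻¹ * ∫ z, u z * cexp (L z) := by
    simp only [mul_comm (u _)]
    rfl
  have hLv : L v = -(I * (inner ℝ k v.1 + inner ℝ l v.2 : ℝ)) := neg_mul _ _
  rw [hfourier, hfourier, ← neg_eq_iff_eq_neg.2 hparts]
  simp only [← mul_assoc, integral_mul_const, hLv]
  ring

end WeakDerivative

section Shell

section Polar

variable {E : Type*} [NormedAddCommGroup E] [NormedSpace ℝ E] [FiniteDimensional ℝ E]
  [Nontrivial E] [MeasurableSpace E] [BorelSpace E] (μ : Measure E) [μ.IsAddHaarMeasure]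

/-- The measure `r ^ n dr` on the positive half-line, as a measure on `ℝ`. -/
noncomputable def radialMeasure (n : ℕ) : Measure ℝ :=
  (volume.restrict (Set.Ioi 0)).withDensity fun r => .ofReal (r ^ n)

theorem measurePreserving_coe_volumeIoiPow (n : ℕ) :
    MeasurePreserving ((↑) : Set.Ioi (0 : ℝ) → ℝ) (.volumeIoiPow n) (radialMeasure n) := by
  refine ⟨measurable_subtype_coe, Measure.ext fun s hs => ?_⟩
  rw [Measure.map_apply measurable_subtype_coe hs, radialMeasure, withDensity_apply _ hs,
    Measure.volumeIoiPow, withDensity_apply _ (measurable_subtype_coe hs)]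
  exact (measurePreserving_subtype_coe measurableSet_Ioi).setLIntegral_comp_preimage
    (f := fun r : ℝ => .ofReal (r ^ n)) hs (by fun_prop)

instance (n : ℕ) : SFinite (radialMeasure n) := by
  unfold radialMeasure
  infer_instance

theorem integrable_radialMeasure_iff {G : Type*} [NormedAddCommGroup G] [NormedSpace ℝ G] {n : ℕ}
    {g : ℝ → G} :
    Integrable g (radialMeasure n) ↔ IntegrableOn (fun r => r ^ n • g r) (Set.Ioi 0) := by
  rw [radialMeasure, integrable_withDensity_iff_integrable_smul' (by fun_prop) (by simp)]
  refine integrableOn_congr_fun (fun r hr => ?_) measurableSet_Ioi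
  rw [ENNReal.toReal_ofReal (pow_nonneg (le_of_lt hr) n)]

theorem integral_radialMeasure {G : Type*} [NormedAddCommGroup G] [NormedSpace ℝ G] {n : ℕ}
    (g : ℝ → G) : ∫ r, g r ∂radialMeasure n = ∫ r in Set.Ioi 0, r ^ n • g r := by
  rw [radialMeasure, integral_withDensity_eq_integral_toReal_smul (by fun_prop) (by simp)]
  refine setIntegral_congr_fun measurableSet_Ioi fun r hr => ?_
  simp only [ENNReal.toReal_ofReal (pow_nonneg (le_of_lt hr) n)]

theorem measurePreserving_smul_sphere :
    MeasurePreserving (fun q : Metric.sphere (0 : E) 1 × ℝ => q.2 • (q.1 : E))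
      (μ.toSphere.prod (radialMeasure (Module.finrank ℝ E - 1))) μ := by
  refine ⟨by fun_prop, ?_⟩
  have hcoe := (MeasurePreserving.id μ.toSphere).prod
    (measurePreserving_coe_volumeIoiPow (Module.finrank ℝ E - 1))
  have hpolar := (measurePreserving_subtype_coe (μa := μ)
    (measurableSet_singleton (0 : E)).compl).comp
      (μ.measurePreserving_homeomorphUnitSphereProd.symm
        (homeomorphUnitSphereProd E).toMeasurableEquiv)
  rw [← hcoe.map_eq, Measure.map_map (by fun_prop) hcoe.measurable]
  exact hpolar.map_eq.trans (restrict_compl_singleton 0)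

variable {μ} {G : Type*} [NormedAddCommGroup G] [NormedSpace ℝ G] {f : E → G}

theorem integrableOn_polar (hf : Integrable f μ) :
    IntegrableOn (fun r : ℝ => r ^ (Module.finrank ℝ E - 1) •
      ∫ σ : Metric.sphere (0 : E) 1, f (r • (σ : E)) ∂μ.toSphere) (Set.Ioi 0) :=
  integrable_radialMeasure_iff.1
    ((measurePreserving_smul_sphere μ).integrable_comp_of_integrable hf).integral_prod_right

theorem integral_polar (hf : Integrable f μ) :
    ∫ l, f l ∂μ = ∫ r in Set.Ioi (0 : ℝ), r ^ (Module.finrank ℝ E - 1) •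
      ∫ σ : Metric.sphere (0 : E) 1, f (r • (σ : E)) ∂μ.toSphere := by
  have hpolar := measurePreserving_smul_sphere μ
  rw [← integral_radialMeasure]
  calc ∫ l, f l ∂μ = ∫ q, f (q.2 • (q.1 : E))
        ∂μ.toSphere.prod (radialMeasure (Module.finrank ℝ E - 1)) := by
        rw [← integral_map hpolar.aemeasurable (hpolar.map_eq.symm ▸ hf.1), hpolar.map_eq]
    _ = _ := integral_prod_symm _ (hpolar.integrable_comp_of_integrable hf)

end Polar

theorem integral_exp_mul_integral_exp {f : ℝ → ℂ} (hf : Integrable f)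
    (hS : Integrable fun t : ℝ => ∫ e : ℝ, cexp (I * (t * e : ℝ)) * f e) {e₀ : ℝ}
    (hcont : ContinuousAt f e₀) :
    ∫ t : ℝ, cexp (-I * (t * e₀ : ℝ)) * ∫ e : ℝ, cexp (I * (t * e : ℝ)) * f e =
      2 * π * f e₀ := by
  set S : ℝ → ℂ := fun t => ∫ e : ℝ, cexp (I * (t * e : ℝ)) * f e with hSdef
  have hfourier : 𝓕 f = fun ξ => S (-(2 * π) * ξ) := by
    funext ξ
    rw [Real.fourier_eq', hSdef]
    refine integral_congr_ae (.of_forall fun e => ?_)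
    simp only [RCLike.inner_apply, conj_trivial, smul_eq_mul]
    push_cast
    ring_nf
  have hinv := hf.fourierInv_fourier_eq (hfourier ▸ hS.comp_mul_left' (by simp [Real.pi_ne_zero]))
    hcont
  have hscale := Measure.integral_comp_mul_left
    (fun t : ℝ => cexp (-I * (t * e₀ : ℝ)) * S t) (-(2 * π))
  rw [abs_inv, abs_neg, abs_of_pos Real.two_pi_pos, eq_inv_smul_iff₀ Real.two_pi_pos.ne',
    Complex.real_smul] at hscale
  rw [← hinv, Real.fourierInv_eq', hfourier, ← hscale]
  push_cast
  congr 2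
  funext ξ
  simp only [RCLike.inner_apply, conj_trivial, smul_eq_mul]
  push_cast
  ring_nf

section Density

variable {d : ℕ} {m : Space d → ℝ}

/-- The density of the measure `m(l) dl` with respect to the energy `e = |l|²`. -/
noncomputable def shellDensity (m : Space d → ℝ) : ℝ → ℝ :=
  (Set.Ioi 0).indicator fun e => √e ^ (d - 2) / 2 *
    ∫ σ : Metric.sphere (0 : Space d) 1, m (√e • (σ : Space d))
      ∂(volume : Measure (Space d)).toSphere

theorem shellDensity_norm_sq (m : Space d → ℝ) {k : Space d} (hk : k ≠ 0) :
    shellDensity m (‖k‖ ^ 2) = shellIntegral k m := by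
  rw [shellDensity, Set.indicator_of_mem (Set.mem_Ioi.2 (by positivity)), shellIntegral,
    Real.sqrt_sq (norm_nonneg k)]

theorem continuous_sphere_integral (hm : Continuous m) :
    Continuous fun r : ℝ => ∫ σ : Metric.sphere (0 : Space d) 1, m (r • (σ : Space d))
      ∂(volume : Measure (Space d)).toSphere := by
  simpa only [Measure.restrict_univ] using continuous_parametric_integral_of_continuous
    (μ := (volume : Measure (Space d)).toSphere)
    (f := fun (r : ℝ) (σ : Metric.sphere (0 : Space d) 1) => m (r • (σ : Space d)))
    (by fun_prop) isCompact_univ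

theorem continuousAt_shellDensity (hm : Continuous m) {e : ℝ} (he : 0 < e) :
    ContinuousAt (shellDensity m) e := by
  have hcont : ContinuousAt (fun e : ℝ => √e ^ (d - 2) / 2 *
      ∫ σ : Metric.sphere (0 : Space d) 1, m (√e • (σ : Space d))
        ∂(volume : Measure (Space d)).toSphere) e :=
    (((Real.continuous_sqrt.pow _).div_const 2).mul
      ((continuous_sphere_integral hm).comp Real.continuous_sqrt)).continuousAt
  refine hcont.congr ?_
  filter_upwards [Ioi_mem_nhds he] with x hx
  rw [shellDensity, Set.indicator_of_mem hx]

/-- The left-hand side is the integrand produced by the substitution `e = r ^ 2`. -/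
theorem shellDensity_rpow_two (hd : 2 ≤ d) (m : Space d → ℝ) {r : ℝ} (hr : 0 < r) :
    (|(2 : ℝ)| * r ^ ((2 : ℝ) - 1)) • shellDensity m (r ^ (2 : ℝ)) =
      r ^ (d - 1) • ∫ σ : Metric.sphere (0 : Space d) 1, m (r • (σ : Space d))
        ∂(volume : Measure (Space d)).toSphere := by
  obtain ⟨n, rfl⟩ := Nat.exists_eq_add_of_le' hd
  rw [Real.rpow_two, shellDensity, Set.indicator_of_mem (Set.mem_Ioi.2 (by positivity)),
    Real.sqrt_sq hr.le, show (2 : ℝ) - 1 = 1 by norm_num, Real.rpow_one, abs_two,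
    show n + 2 - 1 = n + 1 by lia, pow_succ, Nat.add_sub_cancel, smul_eq_mul, smul_eq_mul]
  ring

theorem integrable_shellDensity (hd : 2 ≤ d) (hm : Integrable m) :
    Integrable (shellDensity m) := by
  have : NeZero d := ⟨by lia⟩
  have hpolar := integrableOn_polar hm
  rw [finrank_euclideanSpace_fin] at hpolar
  have hIoi : IntegrableOn (shellDensity m) (Set.Ioi 0) :=
    (integrableOn_Ioi_comp_rpow_iff _ two_ne_zero).1 <|
      hpolar.congr_fun (fun r hr => (shellDensity_rpow_two hd m hr).symm) measurableSet_Ioi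
  exact hIoi.integrable_of_forall_notMem_eq_zero fun e he => Set.indicator_of_notMem he _

theorem integral_exp_mul_shellDensity (hd : 2 ≤ d) (hm : Integrable m) (t : ℝ) :
    ∫ e : ℝ, cexp (I * (t * e : ℝ)) * shellDensity m e =
      ∫ l : Space d, cexp (I * (t * ‖l‖ ^ 2 : ℝ)) * m l := by
  have : NeZero d := ⟨by lia⟩
  have hint : Integrable fun l : Space d => cexp (I * (t * ‖l‖ ^ 2 : ℝ)) * m l :=
    integrable_exp_I_mul hm.ofReal (by fun_prop)
  rw [integral_polar hint, finrank_euclideanSpace_fin,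
    ← setIntegral_eq_integral_of_forall_compl_eq_zero (s := Set.Ioi 0) fun e he => by
      rw [shellDensity, Set.indicator_of_notMem he, Complex.ofReal_zero, mul_zero],
    ← integral_comp_rpow_Ioi _ (two_ne_zero (α := ℝ))]
  refine setIntegral_congr_fun measurableSet_Ioi fun r hr => ?_
  have hnorm (σ : Metric.sphere (0 : Space d) 1) : ‖r • (σ : Space d)‖ = r := by
    rw [norm_smul, norm_eq_of_mem_sphere, mul_one, Real.norm_of_nonneg (le_of_lt hr)]
  have hjac := congrArg Complex.ofReal (shellDensity_rpow_two hd m hr)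
  simp only [hnorm, integral_const_mul, integral_complex_ofReal, Complex.real_smul, smul_eq_mul,
    Real.rpow_two, Complex.ofReal_mul] at hjac ⊢
  linear_combination cexp (I * (t * (r ^ 2 : ℝ))) * hjac

/-- Fourier inversion in the energy variable `e = |l|²`: this is where `2π δ(|k|² - |l|²)` comes
from. -/
theorem integral_exp_mul_schrodinger (hd : 2 ≤ d) (hm : Integrable m) (hcont : Continuous m)
    (hS : Integrable fun t : ℝ => ∫ l : Space d, cexp (I * (t * ‖l‖ ^ 2 : ℝ)) * m l)
    {k : Space d} (hk : k ≠ 0) :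
    ∫ t : ℝ, cexp (-I * (t * ‖k‖ ^ 2 : ℝ)) * ∫ l : Space d, cexp (I * (t * ‖l‖ ^ 2 : ℝ)) * m l =
      2 * π * shellIntegral k m := by
  simp only [← integral_exp_mul_shellDensity hd hm, ← shellDensity_norm_sq m hk] at hS ⊢
  exact integral_exp_mul_integral_exp (integrable_shellDensity hd hm).ofReal hS
    (Complex.continuous_ofReal.continuousAt.comp
      (continuousAt_shellDensity hcont (by positivity)))

end Density

end Shell

section Oscillation

section TimeDecay

/-- The rate of decay `(1 + |t|)⁻ᵖ`. -/
noncomputable def timeDecay (p t : ℝ) : ℝ := (1 + |t|) ^ (-p)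

variable {p : ℝ}

theorem timeDecay_pos (p t : ℝ) : 0 < timeDecay p t := by
  unfold timeDecay
  positivity

theorem integrable_timeDecay (hp : 1 < p) : Integrable (timeDecay p) :=
  integrable_one_add_norm (E := ℝ) (by simpa using hp)

theorem le_mul_timeDecay_iff {x C t : ℝ} : x ≤ C * timeDecay p t ↔ x * (1 + |t|) ^ p ≤ C := by
  rw [timeDecay, Real.rpow_neg (by positivity), ← div_eq_mul_inv, le_div_iff₀ (by positivity)]

theorem timeDecay_add_le (hp : 0 ≤ p) (t s : ℝ) :
    timeDecay p (t + s) ≤ (1 + |s|) ^ p * timeDecay p t := by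
  have habs : 1 + |t| ≤ (1 + |s|) * (1 + |t + s|) := by
    have htri : |t| ≤ |t + s| + |s| := by simpa using abs_sub (t + s) s
    nlinarith [abs_nonneg s, abs_nonneg (t + s)]
  rw [le_mul_timeDecay_iff, timeDecay, Real.rpow_neg (by positivity),
    inv_mul_le_iff₀ (by positivity), mul_comm, ← Real.mul_rpow (by positivity) (by positivity)]
  gcongr

theorem le_mul_timeDecay (hp : 0 ≤ p) {x m C t : ℝ} (hm : 0 ≤ m) (hC : 0 ≤ C) (hxm : x ≤ m)
    (hxC : t ≠ 0 → x ≤ C * |t| ^ (-p)) : x ≤ 2 ^ p * (m + C) * timeDecay p t := by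
  rw [le_mul_timeDecay_iff]
  rcases le_or_gt |t| 1 with ht | ht
  · calc x * (1 + |t|) ^ p ≤ m * 2 ^ p := by gcongr; linarith
      _ ≤ 2 ^ p * (m + C) := by rw [mul_comm]; gcongr; linarith
  · have hpos : 0 < |t| := one_pos.trans ht
    calc x * (1 + |t|) ^ p ≤ C * |t| ^ (-p) * (2 * |t|) ^ p := by
          gcongr
          · exact hxC (abs_pos.1 hpos)
          · linarith
      _ = 2 ^ p * C := by
          rw [Real.mul_rpow zero_le_two hpos.le, Real.rpow_neg hpos.le]
          field_simp
      _ ≤ 2 ^ p * (m + C) := by gcongr; linarith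

end TimeDecay

variable {d : ℕ}

/-- A non-negative weight on pairs of momenta for which the free Schrödinger evolution in the
second variable decays as `|t|^{-d/2}`, uniformly in the first one. -/
structure IsDispersive (M : Space d × Space d → ℝ) : Prop where
  continuous : Continuous M
  nonneg : ∀ z, 0 ≤ M z
  integrable : Integrable M
  decay : ∃ C, 0 ≤ C ∧ ∀ k, Integrable (fun l => M (k, l)) → ∀ t : ℝ, t ≠ 0 →
    ‖∫ l : Space d, cexp (I * (t * ‖l‖ ^ 2 : ℝ)) * M (k, l)‖ ≤ C * |t| ^ (-(d / 2 : ℝ))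

theorem isDispersive_normSq_doubleFourier {u : Space d × Space d → ℂ} (hu : Integrable u)
    (hu2 : MemLp u 2) :
    IsDispersive fun z : Space d × Space d => ‖doubleFourier u (-z.1) z.2‖ ^ 2 where
  continuous := ((continuous_doubleFourier hu).comp
    (by fun_prop : Continuous fun z : Space d × Space d => (-z.1, z.2))).norm.pow 2
  nonneg z := by positivity
  integrable := by
    have hmp : MeasurePreserving (fun z : Space d × Space d => (-z.1, z.2)) :=
      (Measure.measurePreserving_neg volume).prod (MeasurePreserving.id volume)
    have hsq := integrable_normSq_doubleFourier hu hu2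
    exact hmp.integrable_comp_of_integrable hsq
  decay := by
    refine ⟨((2 * π) ^ d)⁻¹ * ((4 * π)⁻¹ ^ (d / 2 : ℝ) * (∫ z, ‖u z‖) ^ 2),
      by positivity, fun k hk t ht => ?_⟩
    have hle := norm_integral_schrodinger_mul_normSq_doubleFourier_le (k := -k) hu hk ht
    refine hle.trans_eq ?_
    rw [mul_inv, Real.mul_rpow (by positivity) (by positivity), Real.inv_rpow (abs_nonneg t),
      Real.rpow_neg (abs_nonneg t)]
    ring

theorem IsDispersive.sum {ι : Type*} {s : Finset ι} {M : ι → Space d × Space d → ℝ}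
    (h : ∀ i ∈ s, IsDispersive (M i)) : IsDispersive fun z => ∑ i ∈ s, M i z where
  continuous := continuous_finsetSum _ fun i hi => (h i hi).continuous
  nonneg z := Finset.sum_nonneg fun i hi => (h i hi).nonneg z
  integrable := integrable_finsetSum _ fun i hi => (h i hi).integrable
  decay := by
    choose! C hC0 hC using fun i hi => (h i hi).decay
    refine ⟨∑ i ∈ s, C i, Finset.sum_nonneg hC0, fun k hk t ht => ?_⟩
    have hslice : ∀ i ∈ s, Integrable fun l => M i (k, l) := fun i hi => by
      refine hk.mono' ((h i hi).continuous.comp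
        (by fun_prop : Continuous fun l : Space d => (k, l))).aestronglyMeasurable
        (.of_forall fun l => ?_)
      rw [Real.norm_of_nonneg ((h i hi).nonneg _)]
      exact Finset.single_le_sum (f := fun i => M i (k, l)) (fun j hj => (h j hj).nonneg _) hi
    have hosc : ∀ i ∈ s, Integrable fun l => cexp (I * (t * ‖l‖ ^ 2 : ℝ)) * M i (k, l) :=
      fun i hi => integrable_exp_I_mul (hslice i hi).ofReal (by fun_prop)
    simp only [Complex.ofReal_sum, Finset.mul_sum]
    rw [integral_finsetSum _ hosc, Finset.sum_mul]
    exact (norm_sum_le _ _).trans (Finset.sum_le_sum fun i hi => hC i hi k (hslice i hi) t ht)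

theorem isDispersive_kernel {w : Kernel d} (hw : IsRegularKernel w) (r r' : Reservoir) :
    IsDispersive fun z : Space d × Space d => ‖kernelFourier w r r' (-z.1) z.2‖ ^ 2 :=
  isDispersive_normSq_doubleFourier (memLp_one_iff_integrable.1 (hw r r').1) (hw r r').2.1

/-- `l_j ŵ` is, up to a factor `i`, the Fourier transform of the weak derivative `∂w/∂y_j`. -/
theorem isDispersive_norm_sq_mul_kernel {w : Kernel d} (hw : IsRegularKernel w)
    (r r' : Reservoir) :
    IsDispersive fun z : Space d × Space d =>
      ‖z.2‖ ^ 2 * ‖kernelFourier w r r' (-z.1) z.2‖ ^ 2 := by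
  obtain ⟨hw1, -, hweak⟩ := hw r r'
  choose w' hw1' hw2' hderiv using fun j : Fin d =>
    hweak ((0 : Space d), EuclideanSpace.single j (1 : ℝ))
  convert IsDispersive.sum (s := Finset.univ) fun j _ =>
    isDispersive_normSq_doubleFourier (memLp_one_iff_integrable.1 (hw1' j)) (hw2' j)
      using 2 with z
  have hcoord (j : Fin d) : doubleFourier (w' j) (-z.1) z.2 =
      I * (z.2 j : ℝ) * doubleFourier (w r r') (-z.1) z.2 := by
    rw [IsWeakDeriv.doubleFourier_eq (hderiv j) (memLp_one_iff_integrable.1 hw1)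
      (memLp_one_iff_integrable.1 (hw1' j)), inner_zero_right, zero_add,
      EuclideanSpace.inner_single_right, one_mul, conj_trivial]
  simp only [hcoord, norm_mul, Complex.norm_I, one_mul, Complex.norm_real, mul_pow,
    ← Finset.sum_mul, EuclideanSpace.norm_sq_eq]
  rfl

/-- The free Schrödinger evolution of a slice of the weight `M`. -/
noncomputable def sliceEvolution (M : Space d × Space d → ℝ) (k : Space d) (t : ℝ) : ℂ :=
  ∫ l : Space d, cexp (I * (t * ‖l‖ ^ 2 : ℝ)) * M (k, l)

/-- A bounded, continuous and integrable function of the momentum. -/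
structure IsWeight (c : Space d → ℝ) : Prop where
  continuous : Continuous c
  integrable : Integrable c
  bounded : ∃ B, ∀ k, ‖c k‖ ≤ B

/-- The oscillatory integral of `c(k) M(k,l) e^{i(t₂|l|² - t₁|k|²)}`. -/
noncomputable def oscillation (c : Space d → ℝ) (M : Space d × Space d → ℝ) (t₁ t₂ : ℝ) : ℂ :=
  ∫ z : Space d × Space d,
    cexp (I * (t₂ * ‖z.2‖ ^ 2 - t₁ * ‖z.1‖ ^ 2 : ℝ)) * (c z.1 * M z : ℝ)

variable {c : Space d → ℝ} {M : Space d × Space d → ℝ}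

theorem IsDispersive.ae_integrable_slice (hM : IsDispersive M) :
    ∀ᵐ k : Space d, Integrable fun l => M (k, l) :=
  Integrable.prod_right_ae (by simpa only [Measure.volume_eq_prod] using hM.integrable)

theorem IsDispersive.exists_norm_sliceEvolution_le (hM : IsDispersive M) :
    ∃ C, 0 ≤ C ∧ ∀ k, Integrable (fun l => M (k, l)) → ∀ t : ℝ,
      ‖sliceEvolution M k t‖ ≤
        2 ^ (d / 2 : ℝ) * ((∫ l, M (k, l)) + C) * timeDecay (d / 2) t := by
  obtain ⟨C, hC0, hC⟩ := hM.decay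
  refine ⟨C, hC0, fun k hk t => le_mul_timeDecay (by positivity)
    (integral_nonneg fun l => hM.nonneg _) hC0 ?_ fun ht => hC k hk t ht⟩
  refine norm_integral_le_of_norm_le hk (.of_forall fun l => ?_)
  rw [norm_mul, norm_exp_I_mul, one_mul, Complex.norm_real, Real.norm_of_nonneg (hM.nonneg _)]

theorem stronglyMeasurable_sliceEvolution (hM : Continuous M) :
    StronglyMeasurable fun p : ℝ × Space d => sliceEvolution M p.2 p.1 := by
  have hcont : Continuous fun q : (ℝ × Space d) × Space d =>
      cexp (I * (q.1.1 * ‖q.2‖ ^ 2 : ℝ)) * M (q.1.2, q.2) := by fun_prop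
  exact hcont.stronglyMeasurable.integral_prod_right

theorem IsWeight.integrable_mul (hc : IsWeight c) (hM : IsDispersive M) :
    Integrable fun z : Space d × Space d => c z.1 * M z := by
  obtain ⟨B, hB⟩ := hc.bounded
  exact hM.integrable.bdd_mul (c := B) (hc.continuous.comp continuous_fst).aestronglyMeasurable
    (.of_forall fun z => hB _)

theorem IsWeight.integrable_norm_mul_slice (hc : IsWeight c) (hM : IsDispersive M) (A C : ℝ) :
    Integrable fun k => ‖c k‖ * (A * ((∫ l, M (k, l)) + C)) := by
  obtain ⟨B, hB⟩ := hc.bounded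
  have hslice : Integrable fun k => ‖c k‖ * ∫ l, M (k, l) :=
    hM.integrable.integral_prod_left.bdd_mul (c := B) hc.continuous.norm.aestronglyMeasurable
      (.of_forall fun k => by rw [norm_norm]; exact hB k)
  refine ((hslice.add (hc.integrable.norm.mul_const C)).const_mul A).congr
    (.of_forall fun k => ?_)
  simp only [Pi.add_apply]
  ring

theorem oscillation_eq (hc : IsWeight c) (hM : IsDispersive M) (t₁ t₂ : ℝ) :
    oscillation c M t₁ t₂ =
      ∫ k : Space d, c k * (cexp (-I * (t₁ * ‖k‖ ^ 2 : ℝ)) * sliceEvolution M k t₂) := by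
  have hosc : Integrable fun z : Space d × Space d =>
      cexp (I * (t₂ * ‖z.2‖ ^ 2 - t₁ * ‖z.1‖ ^ 2 : ℝ)) * (c z.1 * M z : ℝ) :=
    integrable_exp_I_mul (hc.integrable_mul hM).ofReal (by fun_prop)
  rw [Measure.volume_eq_prod] at hosc
  rw [oscillation, Measure.volume_eq_prod, integral_prod _ hosc]
  refine integral_congr_ae (.of_forall fun k => ?_)
  simp only [sliceEvolution, ← integral_const_mul]
  refine integral_congr_ae (.of_forall fun l => ?_)
  have hexp : I * (t₂ * ‖l‖ ^ 2 - t₁ * ‖k‖ ^ 2 : ℝ) =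
      -I * (t₁ * ‖k‖ ^ 2 : ℝ) + I * (t₂ * ‖l‖ ^ 2 : ℝ) := by
    push_cast
    ring
  simp only [hexp, Complex.exp_add, Complex.ofReal_mul]
  ring

theorem oscillation_neg (c : Space d → ℝ) (M : Space d × Space d → ℝ) (t₁ t₂ : ℝ) :
    oscillation c M (-t₁) (-t₂) = conj (oscillation c M t₁ t₂) := by
  rw [oscillation, oscillation, ← integral_conj]
  refine integral_congr_ae (.of_forall fun z => ?_)
  simp only [map_mul, Complex.conj_ofReal, ← Complex.exp_conj, Complex.conj_I]
  push_cast
  ring_nf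

theorem exists_norm_oscillation_le (hc : IsWeight c) (hM : IsDispersive M) :
    ∃ C, 0 ≤ C ∧ ∀ t₁ t₂, ‖oscillation c M t₁ t₂‖ ≤ C * timeDecay (d / 2) t₂ := by
  obtain ⟨C, hC0, hC⟩ := hM.exists_norm_sliceEvolution_le
  refine ⟨∫ k, ‖c k‖ * (2 ^ (d / 2 : ℝ) * ((∫ l, M (k, l)) + C)), integral_nonneg fun k => ?_,
    fun t₁ t₂ => ?_⟩
  · have hslice : 0 ≤ ∫ l, M (k, l) := integral_nonneg fun l => hM.nonneg _
    positivity
  rw [oscillation_eq hc hM, ← integral_mul_const]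
  refine norm_integral_le_of_norm_le ((hc.integrable_norm_mul_slice hM _ C).mul_const _) ?_
  filter_upwards [hM.ae_integrable_slice] with k hk
  rw [norm_mul, norm_mul, Complex.norm_real, norm_exp_neg_I_mul, one_mul, mul_assoc]
  gcongr
  exact hC k hk t₂

theorem continuous_oscillation (hc : IsWeight c) (hM : IsDispersive M) :
    Continuous fun p : ℝ × ℝ => oscillation c M p.1 p.2 := by
  have hint : Integrable fun z : Space d × Space d => ((c z.1 * M z : ℝ) : ℂ) :=
    (hc.integrable_mul hM).ofReal
  refine continuous_of_dominated (fun p => (integrable_exp_I_mul hint (by fun_prop)).1)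
    (fun p => .of_forall fun z => le_of_eq ?_) hint.norm (.of_forall fun z => by fun_prop)
  rw [norm_mul, norm_exp_I_mul, one_mul]

theorem one_lt_half (hd : 3 ≤ d) : 1 < (d / 2 : ℝ) := by
  have : (3 : ℝ) ≤ d := mod_cast hd
  linarith

theorem integrable_oscillation (hd : 3 ≤ d) (hc : IsWeight c) (hM : IsDispersive M) (x y : ℝ) :
    Integrable fun t => oscillation c M (t + x) (t + y) := by
  obtain ⟨C, -, hC⟩ := exists_norm_oscillation_le hc hM
  exact (((integrable_timeDecay (one_lt_half hd)).comp_add_right y).const_mul C).mono'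
    ((continuous_oscillation hc hM).comp
      (by fun_prop : Continuous fun t : ℝ => (t + x, t + y))).aestronglyMeasurable
    (.of_forall fun t => hC _ _)

theorem integrable_mul_sliceEvolution (hd : 3 ≤ d) (hc : IsWeight c) (hM : IsDispersive M) :
    Integrable (fun p : ℝ × Space d =>
      c p.2 * (cexp (-I * (p.1 * ‖p.2‖ ^ 2 : ℝ)) * sliceEvolution M p.2 p.1))
      (volume.prod volume) := by
  obtain ⟨C, -, hC⟩ := hM.exists_norm_sliceEvolution_le
  refine ((integrable_timeDecay (one_lt_half hd)).mul_prod
    (hc.integrable_norm_mul_slice hM (2 ^ (d / 2 : ℝ)) C)).mono' ?_ ?_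
  · exact (hc.continuous.comp continuous_snd).measurable.complex_ofReal.aestronglyMeasurable.mul
      ((Continuous.aestronglyMeasurable (by fun_prop)).mul
        (stronglyMeasurable_sliceEvolution hM.continuous).aestronglyMeasurable)
  · filter_upwards [Measure.quasiMeasurePreserving_snd.ae hM.ae_integrable_slice] with p hp
    rw [norm_mul, norm_mul, Complex.norm_real, norm_exp_neg_I_mul, one_mul,
      mul_comm (timeDecay _ _), mul_assoc]
    gcongr
    exact hC _ hp _

theorem ae_integral_mul_sliceEvolution (hd : 3 ≤ d) (c : Space d → ℝ) (hM : IsDispersive M) :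
    ∀ᵐ k : Space d, ∫ t : ℝ, c k * (cexp (-I * (t * ‖k‖ ^ 2 : ℝ)) * sliceEvolution M k t) =
      2 * π * (c k * shellIntegral k fun l => M (k, l) : ℝ) := by
  obtain ⟨C, -, hC⟩ := hM.exists_norm_sliceEvolution_le
  have : NeZero d := ⟨by lia⟩
  filter_upwards [hM.ae_integrable_slice, Measure.ae_ne volume (0 : Space d)] with k hk hk0
  have hS : Integrable (sliceEvolution M k) := by
    refine ((integrable_timeDecay (one_lt_half hd)).const_mul _).mono' ?_ (.of_forall (hC k hk))
    exact ((stronglyMeasurable_sliceEvolution hM.continuous).comp_measurable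
      (by fun_prop : Measurable fun t : ℝ => (t, k))).aestronglyMeasurable
  simp only [integral_const_mul, sliceEvolution]
  rw [integral_exp_mul_schrodinger (by lia) hk (hM.continuous.comp (by fun_prop)) hS hk0,
    Complex.ofReal_mul]
  ring

theorem integrable_mul_shellIntegral (hd : 3 ≤ d) (hc : IsWeight c) (hM : IsDispersive M) :
    Integrable fun k => c k * shellIntegral k fun l => M (k, l) := by
  have hint : Integrable fun k =>
      (2 * π : ℂ) * (c k * shellIntegral k fun l => M (k, l) : ℝ) :=
    (integrable_mul_sliceEvolution hd hc hM).integral_prod_right.congr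
      (ae_integral_mul_sliceEvolution hd c hM)
  refine (hint.const_mul (2 * π : ℂ)⁻¹).re.congr (.of_forall fun k => ?_)
  beta_reduce
  rw [inv_mul_cancel_left₀ (by simp [Real.pi_ne_zero])]
  exact Complex.ofReal_re _

theorem integral_oscillation (hd : 3 ≤ d) (hc : IsWeight c) (hM : IsDispersive M) :
    ∫ t, oscillation c M t t =
      2 * π * (∫ k, c k * shellIntegral k fun l => M (k, l) : ℝ) := by
  simp only [oscillation_eq hc hM]
  rw [integral_integral_swap (integrable_mul_sliceEvolution hd hc hM),
    ← integral_complex_ofReal, ← integral_const_mul]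
  exact integral_congr_ae (ae_integral_mul_sliceEvolution hd c hM)

end Oscillation

section Correlation

theorem hasDerivAt_integral_exp_I_mul {X : Type*} [TopologicalSpace X] [MeasurableSpace X]
    [OpensMeasurableSpace X] {ν : Measure X} {u : X → ℂ} {θ₀ θ₁ : X → ℝ} (hu : Integrable u ν)
    (h₀ : Continuous θ₀) (h₁ : Continuous θ₁) (hθu : Integrable (fun x => θ₁ x * u x) ν) (s : ℝ) :
    HasDerivAt (fun s : ℝ => ∫ x, cexp (I * (θ₀ x + s * θ₁ x : ℝ)) * u x ∂ν)
      (I * ∫ x, cexp (I * (θ₀ x + s * θ₁ x : ℝ)) * (θ₁ x * u x) ∂ν) s := by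
  have hosc (s : ℝ) : Integrable (fun x => cexp (I * (θ₀ x + s * θ₁ x : ℝ)) * u x) ν :=
    integrable_exp_I_mul hu (by fun_prop)
  rw [← integral_const_mul]
  refine (hasDerivAt_integral_of_dominated_loc_of_deriv_le (s := Set.univ)
    (F := fun s x => cexp (I * (θ₀ x + s * θ₁ x : ℝ)) * u x)
    (F' := fun s x => I * (cexp (I * (θ₀ x + s * θ₁ x : ℝ)) * (θ₁ x * u x)))
    (bound := fun x => ‖θ₁ x * u x‖) univ_mem (.of_forall fun s => (hosc s).1) (hosc s)
    ((integrable_exp_I_mul hθu (by fun_prop)).1.const_mul _)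
    (.of_forall fun x s _ => ?_) hθu.norm (.of_forall fun x s _ => ?_)).2
  · rw [norm_mul, Complex.norm_I, norm_mul, norm_exp_I_mul, one_mul, one_mul]
  · have hphase : HasDerivAt (fun s : ℝ => θ₀ x + s * θ₁ x) (θ₁ x) s := by
      simpa using ((hasDerivAt_id s).mul_const (θ₁ x)).const_add (θ₀ x)
    refine ((hphase.ofReal_comp.const_mul I).cexp.mul_const (u x)).congr_deriv ?_
    ring

variable {d : ℕ} {c : Space d → ℝ} {M : Space d × Space d → ℝ}

/-- `c(k) M(k,l)` satisfies the assumptions for `oscillation` to be defined and to decay, also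
after multiplication by either of the energies `|k|²` and `|l|²`. -/
structure HasEnergyMoments (c : Space d → ℝ) (M : Space d × Space d → ℝ) : Prop where
  weight : IsWeight c
  weight_energy : IsWeight fun k => ‖k‖ ^ 2 * c k
  dispersive : IsDispersive M
  dispersive_energy : IsDispersive fun z => ‖z.2‖ ^ 2 * M z

theorem hasDerivAt_oscillation (h : HasEnergyMoments c M) (a a' t s : ℝ) :
    HasDerivAt (fun s => oscillation c M (t + s * a) (t + s * a'))
      (I * (a' * oscillation c (fun z => ‖z.2‖ ^ 2 * M z) (t + s * a) (t + s * a') -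
        a * oscillation (fun k => ‖k‖ ^ 2 * c k) M (t + s * a) (t + s * a'))) s := by
  have hint : Integrable fun z : Space d × Space d => ((c z.1 * M z : ℝ) : ℂ) :=
    (h.weight.integrable_mul h.dispersive).ofReal
  have hint₁ : Integrable fun z : Space d × Space d =>
      ((‖z.1‖ ^ 2 * c z.1 * M z : ℝ) : ℂ) :=
    (h.weight_energy.integrable_mul h.dispersive).ofReal
  have hint₂ : Integrable fun z : Space d × Space d =>
      ((c z.1 * (‖z.2‖ ^ 2 * M z) : ℝ) : ℂ) :=
    (h.weight.integrable_mul h.dispersive_energy).ofReal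
  have hθ (z : Space d × Space d) :
      ((a' * ‖z.2‖ ^ 2 - a * ‖z.1‖ ^ 2 : ℝ) : ℂ) * (c z.1 * M z : ℝ) =
        a' * (c z.1 * (‖z.2‖ ^ 2 * M z) : ℝ) - a * (‖z.1‖ ^ 2 * c z.1 * M z : ℝ) := by
    push_cast
    ring
  have hphase (s : ℝ) (z : Space d × Space d) :
      (t + s * a') * ‖z.2‖ ^ 2 - (t + s * a) * ‖z.1‖ ^ 2 =
        t * (‖z.2‖ ^ 2 - ‖z.1‖ ^ 2) + s * (a' * ‖z.2‖ ^ 2 - a * ‖z.1‖ ^ 2) := by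
    ring
  have hθint : Integrable fun z : Space d × Space d =>
      ((a' * ‖z.2‖ ^ 2 - a * ‖z.1‖ ^ 2 : ℝ) : ℂ) * (c z.1 * M z : ℝ) := by
    simp only [hθ]
    exact (hint₂.const_mul _).sub (hint₁.const_mul _)
  have hθc : Continuous fun z : Space d × Space d =>
      t * (‖z.2‖ ^ 2 - ‖z.1‖ ^ 2) + s * (a' * ‖z.2‖ ^ 2 - a * ‖z.1‖ ^ 2) := by
    fun_prop
  simp only [oscillation, hphase]
  refine (hasDerivAt_integral_exp_I_mul hint (by fun_prop) (by fun_prop) hθint s).congr_deriv ?_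
  congr 1
  rw [← integral_const_mul, ← integral_const_mul, ← integral_sub
    ((integrable_exp_I_mul hint₂ hθc).const_mul _) ((integrable_exp_I_mul hint₁ hθc).const_mul _)]
  congr 1 with z
  rw [hθ]
  ring

/-- The contribution of a pair of reservoirs to `ω([W(t), γ_s(W)])`, where the flow `γ` multiplies
creation operators of momentum `k` in the two reservoirs by `exp (i s (a |k|² + b))` and
`exp (i s (a' |k|² + b'))`. -/
noncomputable def correlation (c : Space d → ℝ) (M : Space d × Space d → ℝ)
    (a a' b b' t s : ℝ) : ℂ :=
  cexp (I * (s * (b' - b) : ℝ)) * oscillation c M (t + s * a) (t + s * a')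

/-- `-i` times the derivative of `correlation` with respect to `s`. -/
noncomputable def correlationDeriv (c : Space d → ℝ) (M : Space d × Space d → ℝ)
    (a a' b b' t s : ℝ) : ℂ :=
  cexp (I * (s * (b' - b) : ℝ)) *
    (a' * oscillation c (fun z => ‖z.2‖ ^ 2 * M z) (t + s * a) (t + s * a') -
      a * oscillation (fun k => ‖k‖ ^ 2 * c k) M (t + s * a) (t + s * a') +
      (b' - b : ℝ) * oscillation c M (t + s * a) (t + s * a'))

theorem hasDerivAt_correlation (h : HasEnergyMoments c M) (a a' b b' t s : ℝ) :
    HasDerivAt (correlation c M a a' b b' t) (I * correlationDeriv c M a a' b b' t s) s := by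
  have hphase : HasDerivAt (fun s : ℝ => s * (b' - b)) (b' - b) s := by
    simpa using (hasDerivAt_id s).mul_const (b' - b)
  refine ((hphase.ofReal_comp.const_mul I).cexp.fun_mul
    (hasDerivAt_oscillation h a a' t s)).congr_deriv ?_
  rw [correlationDeriv]
  ring

theorem integrable_correlation (hd : 3 ≤ d) (h : HasEnergyMoments c M) (a a' b b' s : ℝ) :
    Integrable fun t => correlation c M a a' b b' t s :=
  (integrable_oscillation hd h.weight h.dispersive _ _).const_mul _

theorem integrable_correlationDeriv (hd : 3 ≤ d) (h : HasEnergyMoments c M)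
    (a a' b b' s : ℝ) : Integrable fun t => correlationDeriv c M a a' b b' t s :=
  ((((integrable_oscillation hd h.weight h.dispersive_energy _ _).const_mul _).sub
    ((integrable_oscillation hd h.weight_energy h.dispersive _ _).const_mul _)).add
    ((integrable_oscillation hd h.weight h.dispersive _ _).const_mul _)).const_mul _

theorem exists_norm_correlationDeriv_le (h : HasEnergyMoments c M) (a a' b b' : ℝ) :
    ∃ C, ∀ t s, |s| ≤ 1 → ‖correlationDeriv c M a a' b b' t s‖ ≤ C * timeDecay (d / 2) t := by
  obtain ⟨C₁, hC₁0, hC₁⟩ := exists_norm_oscillation_le h.weight h.dispersive_energy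
  obtain ⟨C₂, hC₂0, hC₂⟩ := exists_norm_oscillation_le h.weight_energy h.dispersive
  obtain ⟨C₃, hC₃0, hC₃⟩ := exists_norm_oscillation_le h.weight h.dispersive
  refine ⟨(|a'| * C₁ + |a| * C₂ + |b' - b| * C₃) * (1 + |a'|) ^ (d / 2 : ℝ), fun t s hs => ?_⟩
  have hdecay : timeDecay (d / 2) (t + s * a') ≤
      (1 + |a'|) ^ (d / 2 : ℝ) * timeDecay (d / 2) t := by
    have hle : |s * a'| ≤ |a'| := by
      rw [abs_mul]
      exact mul_le_of_le_one_left (abs_nonneg _) hs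
    refine (timeDecay_add_le (by positivity) _ _).trans ?_
    gcongr
    exact (timeDecay_pos _ _).le
  calc ‖correlationDeriv c M a a' b b' t s‖
      ≤ |a'| * (C₁ * timeDecay (d / 2) (t + s * a')) +
        |a| * (C₂ * timeDecay (d / 2) (t + s * a')) +
        |b' - b| * (C₃ * timeDecay (d / 2) (t + s * a')) := by
        rw [correlationDeriv, norm_mul, norm_exp_I_mul, one_mul]
        refine (norm_add_le _ _).trans (add_le_add ((norm_sub_le _ _).trans (add_le_add ?_ ?_)) ?_)
        all_goals rw [norm_mul, Complex.norm_real, Real.norm_eq_abs]; gcongr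
        exacts [hC₁ _ _, hC₂ _ _, hC₃ _ _]
    _ = (|a'| * C₁ + |a| * C₂ + |b' - b| * C₃) * timeDecay (d / 2) (t + s * a') := by ring
    _ ≤ _ := by
        rw [mul_assoc]
        gcongr

theorem hasDerivAt_integral_correlation (hd : 3 ≤ d) (h : HasEnergyMoments c M)
    (a a' b b' : ℝ) :
    HasDerivAt (fun s => ∫ t in Set.Ioi 0, correlation c M a a' b b' t s)
      (I * ∫ t in Set.Ioi 0, correlationDeriv c M a a' b b' t 0) 0 := by
  obtain ⟨C, hC⟩ := exists_norm_correlationDeriv_le h a a' b b'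
  rw [← integral_const_mul]
  refine (hasDerivAt_integral_of_dominated_loc_of_deriv_le (μ := volume.restrict (Set.Ioi 0))
    (F := fun s t => correlation c M a a' b b' t s)
    (F' := fun s t => I * correlationDeriv c M a a' b b' t s)
    (bound := fun t => C * timeDecay (d / 2) t) (Metric.ball_mem_nhds _ one_pos)
    (.of_forall fun s => (integrable_correlation hd h a a' b b' s).1.restrict)
    (integrable_correlation hd h a a' b b' 0).restrict
    ((integrable_correlationDeriv hd h a a' b b' 0).1.restrict.const_mul _)
    (.of_forall fun t s hs => ?_)
    ((integrable_timeDecay (one_lt_half hd)).const_mul C).restrict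
    (.of_forall fun t s _ => hasDerivAt_correlation h a a' b b' t s)).2
  rw [norm_mul, Complex.norm_I, one_mul]
  exact hC t s (mem_ball_zero_iff.1 hs).le

theorem correlationDeriv_zero (c : Space d → ℝ) (M : Space d × Space d → ℝ)
    (a a' b b' t : ℝ) :
    correlationDeriv c M a a' b b' t 0 =
      a' * oscillation c (fun z => ‖z.2‖ ^ 2 * M z) t t -
        a * oscillation (fun k => ‖k‖ ^ 2 * c k) M t t + (b' - b : ℝ) * oscillation c M t t := by
  simp only [correlationDeriv, zero_mul, Complex.ofReal_zero, mul_zero, Complex.exp_zero, one_mul,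
    add_zero]

theorem shellIntegral_mul_left (k : Space d) (y : ℝ → ℝ) (m : Space d → ℝ) :
    (shellIntegral k fun l => y ‖l‖ * m l) = y ‖k‖ * shellIntegral k m := by
  simp only [shellIntegral, norm_smul, norm_norm, norm_eq_of_mem_sphere, mul_one]
  rw [integral_const_mul]
  ring

theorem integral_correlationDeriv (hd : 3 ≤ d) (h : HasEnergyMoments c M) (a a' b b' : ℝ) :
    ∫ t, correlationDeriv c M a a' b b' t 0 = 2 * π * (∫ k, c k *
      (((a' - a) * ‖k‖ ^ 2 + (b' - b)) * shellIntegral k fun l => M (k, l)) : ℝ) := by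
  have hosc₁ := integrable_oscillation hd h.weight h.dispersive_energy 0 0
  have hosc₂ := integrable_oscillation hd h.weight_energy h.dispersive 0 0
  have hosc₃ := integrable_oscillation hd h.weight h.dispersive 0 0
  simp only [add_zero] at hosc₁ hosc₂ hosc₃
  have honShell : (fun k => c k * shellIntegral k fun l => ‖l‖ ^ 2 * M (k, l)) =
      fun k => ‖k‖ ^ 2 * c k * shellIntegral k fun l => M (k, l) := by
    ext k
    rw [shellIntegral_mul_left k (· ^ 2)]
    ring
  have hsplit : (∫ k, c k * (((a' - a) * ‖k‖ ^ 2 + (b' - b)) *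
        shellIntegral k fun l => M (k, l))) =
      (a' - a) * (∫ k, ‖k‖ ^ 2 * c k * shellIntegral k fun l => M (k, l)) +
      (b' - b) * (∫ k, c k * shellIntegral k fun l => M (k, l)) := by
    rw [← integral_const_mul, ← integral_const_mul, ← integral_add
      ((integrable_mul_shellIntegral hd h.weight_energy h.dispersive).const_mul _)
      ((integrable_mul_shellIntegral hd h.weight h.dispersive).const_mul _)]
    congr 1 with k
    ring
  simp only [correlationDeriv_zero]
  rw [integral_add ((hosc₁.const_mul _).sub' (hosc₂.const_mul _)) (hosc₃.const_mul _),
    integral_sub (hosc₁.const_mul _) (hosc₂.const_mul _), integral_const_mul, integral_const_mul,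
    integral_const_mul, integral_oscillation hd h.weight h.dispersive_energy,
    integral_oscillation hd h.weight_energy h.dispersive,
    integral_oscillation hd h.weight h.dispersive, honShell, hsplit]
  push_cast
  ring

theorem integral_Ioi_correlationDeriv_add_conj (hd : 3 ≤ d) (h : HasEnergyMoments c M)
    (a a' b b' : ℝ) :
    (∫ t in Set.Ioi 0, correlationDeriv c M a a' b b' t 0) +
      conj (∫ t in Set.Ioi 0, correlationDeriv c M a a' b b' t 0) =
      ∫ t, correlationDeriv c M a a' b b' t 0 := by
  have hint := integrable_correlationDeriv hd h a a' b b' 0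
  have hconj (t : ℝ) : conj (correlationDeriv c M a a' b b' t 0) =
      correlationDeriv c M a a' b b' (-t) 0 := by
    simp only [correlationDeriv_zero, oscillation_neg, map_add, map_sub, map_mul,
      Complex.conj_ofReal]
  simp_rw [← integral_conj, hconj]
  rw [integral_comp_neg_Ioi 0 fun t => correlationDeriv c M a a' b b' t 0, neg_zero, add_comm]
  exact intervalIntegral.integral_Iic_add_Ioi hint.integrableOn hint.integrableOn

end Correlation

section Equilibrium

variable {d : ℕ} {𝔄 : Type*} [CStarAlgebra 𝔄]

theorem continuous_starAlgHom (γ : 𝔄 →⋆ₐ[ℂ] 𝔄) : Continuous γ :=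
  AddMonoidHomClass.continuous_of_bound γ 1 fun x => by
    rw [one_mul]
    exact NonUnitalStarAlgHom.norm_apply_le γ x

section NormalOrdering

variable (F : FieldAlgebra d 𝔄)

/-- The normal-ordered monomial `a*(f₁) ⋯ a*(fₙ) a(g₁) ⋯ a(gₘ)`. -/
noncomputable def normalMonomial (L L' : List (OneParticle d)) : 𝔄 :=
  (L.map fun f => star (F.a f)).prod * (L'.map F.a).prod

/-- The linear span of the normal-ordered monomials. -/
noncomputable def normalSpan : Submodule ℂ 𝔄 :=
  Submodule.span ℂ (Set.range fun p : List (OneParticle d) × List (OneParticle d) =>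
    normalMonomial F p.1 p.2)

variable {F}

theorem normalMonomial_mem_normalSpan (L L' : List (OneParticle d)) :
    normalMonomial F L L' ∈ normalSpan F :=
  Submodule.subset_span ⟨(L, L'), rfl⟩

theorem star_mul_normalMonomial (f : OneParticle d) (L L' : List (OneParticle d)) :
    star (F.a f) * normalMonomial F L L' = normalMonomial F (f :: L) L' := by
  simp only [normalMonomial, List.map_cons, List.prod_cons, mul_assoc]

theorem mul_normalMonomial_nil (f : OneParticle d) (L' : List (OneParticle d)) :
    F.a f * normalMonomial F [] L' = normalMonomial F [] (f :: L') := by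
  simp only [normalMonomial, List.map_nil, List.prod_nil, one_mul, List.map_cons, List.prod_cons]

theorem mul_normalMonomial_cons (f g : OneParticle d) (L L' : List (OneParticle d)) :
    F.a f * normalMonomial F (g :: L) L' =
      (inner ℂ f g : ℂ) • normalMonomial F L L' -
        star (F.a g) * (F.a f * normalMonomial F L L') := by
  rw [← star_mul_normalMonomial, ← mul_assoc, ← mul_assoc, eq_sub_iff_add_eq, ← add_mul,
    F.anticomm_star, smul_mul_assoc, one_mul]

theorem mul_mem_normalSpan_of_normalMonomial {y : 𝔄}
    (hy : ∀ L L', y * normalMonomial F L L' ∈ normalSpan F) {x : 𝔄} (hx : x ∈ normalSpan F) :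
    y * x ∈ normalSpan F := by
  have hle : normalSpan F ≤ (normalSpan F).comap (LinearMap.mulLeft ℂ y) :=
    Submodule.span_le.2 (by rintro _ ⟨p, rfl⟩; exact hy p.1 p.2)
  exact hle hx

theorem star_mul_mem_normalSpan (f : OneParticle d) {x : 𝔄} (hx : x ∈ normalSpan F) :
    star (F.a f) * x ∈ normalSpan F :=
  mul_mem_normalSpan_of_normalMonomial (fun L L' => by
    rw [star_mul_normalMonomial]
    exact normalMonomial_mem_normalSpan _ _) hx

theorem mul_mem_normalSpan (f : OneParticle d) {x : 𝔄} (hx : x ∈ normalSpan F) :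
    F.a f * x ∈ normalSpan F := by
  refine mul_mem_normalSpan_of_normalMonomial (fun L L' => ?_) hx
  induction L with
  | nil =>
    rw [mul_normalMonomial_nil]
    exact normalMonomial_mem_normalSpan _ _
  | cons g L ih =>
    rw [mul_normalMonomial_cons]
    exact sub_mem (Submodule.smul_mem _ _ (normalMonomial_mem_normalSpan _ _))
      (star_mul_mem_normalSpan g ih)

theorem adjoin_mul_mem_normalSpan {x : 𝔄} (hx : x ∈ StarAlgebra.adjoin ℂ (Set.range F.a))
    {y : 𝔄} (hy : y ∈ normalSpan F) : x * y ∈ normalSpan F := by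
  rw [← StarSubalgebra.mem_toSubalgebra, StarAlgebra.adjoin_toSubalgebra] at hx
  induction hx using Algebra.adjoin_induction generalizing y with
  | mem x hx =>
    rcases hx with ⟨f, rfl⟩ | ⟨f, hf⟩
    · exact mul_mem_normalSpan f hy
    · rw [← star_star x, ← hf]
      exact star_mul_mem_normalSpan f hy
  | algebraMap r =>
    rw [← Algebra.smul_def]
    exact Submodule.smul_mem _ _ hy
  | add x x' _ _ hx hx' =>
    rw [add_mul]
    exact add_mem (hx hy) (hx' hy)
  | mul x x' _ _ hx hx' =>
    rw [mul_assoc]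
    exact hx (hx' hy)

theorem dense_normalSpan : Dense (normalSpan F : Set 𝔄) := by
  have hone : (1 : 𝔄) ∈ normalSpan F := by
    simpa only [normalMonomial, List.map_nil, List.prod_nil, one_mul] using
      normalMonomial_mem_normalSpan (F := F) [] []
  have hsub : (StarAlgebra.adjoin ℂ (Set.range F.a) : Set 𝔄) ⊆ normalSpan F := fun x hx => by
    simpa only [mul_one, SetLike.mem_coe] using adjoin_mul_mem_normalSpan hx hone
  have hdense : Dense (StarAlgebra.adjoin ℂ (Set.range F.a) : Set 𝔄) := by
    rw [dense_iff_closure_eq, ← StarSubalgebra.topologicalClosure_coe, F.generates]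
    rfl
  exact hdense.mono hsub

end NormalOrdering

section Invariance

variable {F : FieldAlgebra d 𝔄} {β μ : Reservoir → ℝ} {ω : 𝔄 →L[ℂ] ℂ}

theorem IsProductEquilibrium.apply_ofFn_eq (hω : IsProductEquilibrium F β μ ω)
    {U : OneParticle d → OneParticle d}
    (hU : ∀ f g, ω (star (F.a (U f)) * F.a (U g)) = ω (star (F.a f) * F.a g))
    (n : ℕ) (f g : Fin n → OneParticle d) :
    ω ((List.ofFn fun i => star (F.a (U (f i)))).prod *
        (List.ofFn fun j => F.a (U (g j))).prod) =
      ω ((List.ofFn fun i => star (F.a (f i))).prod * (List.ofFn fun j => F.a (g j)).prod) := by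
  induction n with
  | zero => simp only [List.ofFn_zero]
  | succ n ih =>
    rw [hω.wick n (fun i => U (f i)) (fun i => U (g i)), hω.wick n f g]
    refine Finset.sum_congr rfl fun p _ => ?_
    rw [hU, ih (fun i => f i.succ) (fun j => g (p.succAbove j))]

theorem IsProductEquilibrium.apply_normalMonomial_eq (hω : IsProductEquilibrium F β μ ω)
    {U : OneParticle d → OneParticle d}
    (hU : ∀ f g, ω (star (F.a (U f)) * F.a (U g)) = ω (star (F.a f) * F.a g))
    (L L' : List (OneParticle d)) :
    ω (normalMonomial F (L.map U) (L'.map U)) = ω (normalMonomial F L L') := by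
  obtain ⟨n, f, rfl⟩ : ∃ n, ∃ f : Fin n → OneParticle d, L = List.ofFn f :=
    ⟨_, L.get, (List.ofFn_get L).symm⟩
  obtain ⟨m, g, rfl⟩ : ∃ m, ∃ g : Fin m → OneParticle d, L' = List.ofFn g :=
    ⟨_, L'.get, (List.ofFn_get L').symm⟩
  simp only [normalMonomial, List.map_ofFn, Function.comp_def]
  by_cases hnm : n = m
  · subst hnm
    exact hω.apply_ofFn_eq hU n f g
  · rw [hω.off_diagonal _ _ (fun i => U (f i)) (fun j => U (g j)) hnm,
      hω.off_diagonal _ _ f g hnm]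

theorem IsProductEquilibrium.apply_starAlgHom_eq (hω : IsProductEquilibrium F β μ ω)
    {U : OneParticle d → OneParticle d}
    (hU : ∀ f g, ω (star (F.a (U f)) * F.a (U g)) = ω (star (F.a f) * F.a g))
    {γ : 𝔄 →⋆ₐ[ℂ] 𝔄} (hγ : ∀ f, γ (F.a f) = F.a (U f)) (x : 𝔄) : ω (γ x) = ω x := by
  have hspan : Set.EqOn ((ω : 𝔄 →ₗ[ℂ] ℂ) ∘ₗ γ.toAlgHom.toLinearMap) (ω : 𝔄 →ₗ[ℂ] ℂ)
      (normalSpan F) := by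
    refine LinearMap.eqOn_span ?_
    rintro _ ⟨⟨L, L'⟩, rfl⟩
    have hmap : γ (normalMonomial F L L') = normalMonomial F (L.map U) (L'.map U) := by
      simp only [normalMonomial, map_mul, map_list_prod, List.map_map, Function.comp_def,
        map_star, hγ]
    exact (congrArg ω hmap).trans (hω.apply_normalMonomial_eq hU L L')
  exact congrFun ((ω.continuous.comp (continuous_starAlgHom γ)).ext_on dense_normalSpan
    ω.continuous hspan) x

/-- `f'` is obtained from `f` by multiplying its component in each reservoir `r` by the phase
`exp (i θ r |k|)`. -/
def IsPhase (θ : Reservoir → ℝ → ℝ) (f f' : OneParticle d) : Prop :=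
  ∀ r, (f' r : Space d → ℂ) =ᵐ[volume] fun k => cexp (I * θ r ‖k‖) * f r k

theorem isPhase_phase (r : Reservoir) {θ : ℝ → ℝ} (hθ : Continuous θ) (f : OneParticle d) :
    IsPhase (fun r' κ => if r' = r then θ κ else 0) f (phase r θ hθ f) := by
  intro r'
  by_cases h : r' = r
  · simp only [phase, h, if_true]
    exact MemLp.coeFn_toLp _
  · simp only [phase, h, if_false, Complex.ofReal_zero, mul_zero, Complex.exp_zero, one_mul]
    rfl

theorem IsPhase.trans {θ θ' : Reservoir → ℝ → ℝ} {f f' f'' : OneParticle d}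
    (h : IsPhase θ f f') (h' : IsPhase θ' f' f'') :
    IsPhase (fun r κ => θ r κ + θ' r κ) f f'' := by
  intro r
  filter_upwards [h r, h' r] with k hk hk'
  rw [hk', hk, ← mul_assoc, ← Complex.exp_add, ← mul_add, Complex.ofReal_add,
    add_comm (θ r ‖k‖ : ℂ)]

theorem IsPhase.norm_apply_eq {θ : Reservoir → ℝ → ℝ} {f f' : OneParticle d}
    (h : IsPhase θ f f') (r : Reservoir) : ‖f' r‖ = ‖f r‖ := by
  rw [Lp.norm_def, Lp.norm_def]
  congr 1
  refine eLpNorm_congr_norm_ae ?_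
  filter_upwards [h r] with k hk
  rw [hk, norm_mul, norm_exp_I_mul, one_mul]

theorem IsPhase.norm_eq {θ : Reservoir → ℝ → ℝ} {f f' : OneParticle d} (h : IsPhase θ f f') :
    ‖f'‖ = ‖f‖ := by
  simp only [PiLp.norm_eq_of_L2, h.norm_apply_eq]

theorem conj_exp_I_mul (x : ℝ) : conj (cexp (I * x)) = cexp (-I * x) := by
  rw [← Complex.exp_conj, map_mul, Complex.conj_I, Complex.conj_ofReal]

theorem IsProductEquilibrium.two_point_phase (hω : IsProductEquilibrium F β μ ω)
    {θ : Reservoir → ℝ → ℝ} {f f' g g' : OneParticle d} (hf : IsPhase θ f f')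
    (hg : IsPhase θ g g') : ω (star (F.a f') * F.a g') = ω (star (F.a f) * F.a g) := by
  rw [hω.two_point, hω.two_point]
  refine Finset.sum_congr rfl fun r _ => integral_congr_ae ?_
  filter_upwards [hf r, hg r] with k hk hk'
  have hcancel : cexp (I * θ r ‖k‖) * cexp (-I * θ r ‖k‖) = 1 := by
    rw [← Complex.exp_add, neg_mul, add_neg_cancel, Complex.exp_zero]
  rw [hk, hk', map_mul, conj_exp_I_mul]
  linear_combination (fermi β μ r k : ℂ) * f r k * conj (g r k) * hcancel

theorem IsProductEquilibrium.apply_phase_eq (hω : IsProductEquilibrium F β μ ω)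
    {θ : Reservoir → ℝ → ℝ} {U : OneParticle d → OneParticle d} (hU : ∀ f, IsPhase θ f (U f))
    {γ : 𝔄 →⋆ₐ[ℂ] 𝔄} (hγ : ∀ f, γ (F.a f) = F.a (U f)) (x : 𝔄) : ω (γ x) = ω x :=
  hω.apply_starAlgHom_eq (fun f g => hω.two_point_phase (hU f) (hU g)) hγ x

end Invariance

end Equilibrium

section Trace

variable {X : Type*} [MeasurableSpace X] {ν : Measure X}

theorem integrable_mul_conj (f g : Lp ℂ 2 ν) : Integrable (fun x => f x * conj (g x)) ν :=
  (L2.integrable_inner (𝕜 := ℂ) g f).congr (.of_forall fun _ => rfl)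

theorem integral_norm_mul_conj_le (f g : Lp ℂ 2 ν) :
    ∫ x, ‖f x * conj (g x)‖ ∂ν ≤ ‖f‖ * ‖g‖ := by
  have hnorm (h : Lp ℂ 2 ν) : ‖h‖ = (∫ x, ‖h x‖ ^ (2 : ℝ) ∂ν) ^ (1 / (2 : ℝ)) := by
    rw [Lp.norm_def, (Lp.memLp h).eLpNorm_eq_integral_rpow_norm two_ne_zero ENNReal.ofNat_ne_top,
      ENNReal.toReal_ofReal (by positivity), ENNReal.toReal_ofNat, one_div]
  simp only [norm_mul, RCLike.norm_conj]
  rw [hnorm f, hnorm g]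
  refine integral_mul_norm_le_Lp_mul_Lq Real.HolderConjugate.two_two ?_ ?_
  · simpa using Lp.memLp f
  · simpa using Lp.memLp g

section Weighted

variable {c : X → ℂ} {B : ℝ}

theorem integrable_mul_mul_conj (hc : AEStronglyMeasurable c ν) (hB : ∀ x, ‖c x‖ ≤ B)
    (f g : Lp ℂ 2 ν) : Integrable (fun x => c x * (f x * conj (g x))) ν :=
  (integrable_mul_conj f g).bdd_mul hc (.of_forall hB)

theorem integral_norm_mul_mul_conj_le (hB0 : 0 ≤ B) (hB : ∀ x, ‖c x‖ ≤ B) (f g : Lp ℂ 2 ν) :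
    ∫ x, ‖c x * (f x * conj (g x))‖ ∂ν ≤ B * (‖f‖ * ‖g‖) := by
  calc ∫ x, ‖c x * (f x * conj (g x))‖ ∂ν ≤ ∫ x, B * ‖f x * conj (g x)‖ ∂ν := by
        refine integral_mono_of_nonneg (.of_forall fun _ => norm_nonneg _)
          ((integrable_mul_conj f g).norm.const_mul B) (.of_forall fun x => ?_)
        beta_reduce
        rw [norm_mul]
        gcongr
        exact hB x
    _ ≤ B * (‖f‖ * ‖g‖) := by
        rw [integral_const_mul]
        gcongr
        exact integral_norm_mul_conj_le f g

end Weighted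

theorem hasSum_prod_mul {ι κ : Type*} {x : ι → ℂ} {y : κ → ℂ} {a b : ℂ} (hx : HasSum x a)
    (hy : HasSum y b) : HasSum (fun p : ι × κ => x p.1 * y p.2) (a * b) :=
  hx.mul hy (summable_mul_of_summable_norm hx.summable.norm hy.summable.norm)

variable [SFinite ν] {ι κ : Type*}

theorem ae_hasSum_kernel_mul_swap {f g : ι → Lp ℂ 2 ν} {f' g' : κ → Lp ℂ 2 ν}
    {K K' : X × X → ℂ}
    (hK : ∀ᵐ z ∂ν.prod ν, HasSum (fun n => f n z.1 * conj (g n z.2)) (K z))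
    (hK' : ∀ᵐ z ∂ν.prod ν, HasSum (fun n => f' n z.1 * conj (g' n z.2)) (K' z)) (c : X → ℂ) :
    ∀ᵐ z ∂ν.prod ν, HasSum (fun p : ι × κ =>
      (c z.1 * (f p.1 z.1 * conj (g' p.2 z.1))) * (f' p.2 z.2 * conj (g p.1 z.2)))
      (c z.1 * (K z * K' z.swap)) := by
  filter_upwards [hK, Measure.measurePreserving_swap.quasiMeasurePreserving.ae hK'] with z hz hz'
  refine ((hasSum_prod_mul hz hz').mul_left (c z.1)).congr_fun fun p => ?_
  simp only [Prod.fst_swap, Prod.snd_swap]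
  ring

/-- The left-hand side is `Tr (c A A')` for the trace class operators `A = ∑ |fₙ⟩⟨gₙ|` and
`A' = ∑ |f'ₙ⟩⟨g'ₙ|`, expanded into matrix elements. -/
theorem hasSum_trace [Countable ι] [Countable κ] {f g : ι → Lp ℂ 2 ν} {f' g' : κ → Lp ℂ 2 ν}
    (hs : Summable fun n => ‖f n‖ * ‖g n‖) (hs' : Summable fun n => ‖f' n‖ * ‖g' n‖)
    {K K' : X × X → ℂ}
    (hK : ∀ᵐ z ∂ν.prod ν, HasSum (fun n => f n z.1 * conj (g n z.2)) (K z))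
    (hK' : ∀ᵐ z ∂ν.prod ν, HasSum (fun n => f' n z.1 * conj (g' n z.2)) (K' z))
    {c : X → ℂ} (hc : AEStronglyMeasurable c ν) {B : ℝ} (hB0 : 0 ≤ B) (hB : ∀ x, ‖c x‖ ≤ B) :
    HasSum (fun p : ι × κ => (∫ x, c x * (f p.1 x * conj (g' p.2 x)) ∂ν) *
        ∫ y, f' p.2 y * conj (g p.1 y) ∂ν)
      (∫ z, c z.1 * (K z * K' z.swap) ∂ν.prod ν) := by
  have hsummable : Summable fun p : ι × κ => ∫ z : X × X,
      ‖(c z.1 * (f p.1 z.1 * conj (g' p.2 z.1))) * (f' p.2 z.2 * conj (g p.1 z.2))‖ ∂ν.prod ν := by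
    have hprod : Summable fun p : ι × κ => B * ((‖f p.1‖ * ‖g p.1‖) * (‖f' p.2‖ * ‖g' p.2‖)) :=
      (hs.mul_of_nonneg hs' (fun _ => by positivity) (fun _ => by positivity)).mul_left B
    refine hprod.of_nonneg_of_le (fun p => integral_nonneg fun z => norm_nonneg _) fun p => ?_
    simp_rw [norm_mul _ (f' p.2 _ * _)]
    rw [integral_prod_mul (fun x => ‖c x * (f p.1 x * conj (g' p.2 x))‖)
      (fun y => ‖f' p.2 y * conj (g p.1 y)‖)]
    calc _ ≤ (B * (‖f p.1‖ * ‖g' p.2‖)) * (‖f' p.2‖ * ‖g p.1‖) :=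
          mul_le_mul (integral_norm_mul_mul_conj_le hB0 hB _ _) (integral_norm_mul_conj_le _ _)
            (integral_nonneg fun _ => norm_nonneg _) (by positivity)
      _ = _ := by ring
  have hsum := hasSum_integral_of_summable_integral_norm
    (fun p : ι × κ => (integrable_mul_mul_conj hc hB (f p.1) (g' p.2)).mul_prod
      (integrable_mul_conj (f' p.2) (g p.1))) hsummable
  have hfactor (p : ι × κ) : (∫ z : X × X, (c z.1 * (f p.1 z.1 * conj (g' p.2 z.1))) *
      (f' p.2 z.2 * conj (g p.1 z.2)) ∂ν.prod ν) =
      (∫ x, c x * (f p.1 x * conj (g' p.2 x)) ∂ν) * ∫ y, f' p.2 y * conj (g p.1 y) ∂ν :=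
    integral_prod_mul (fun x => c x * (f p.1 x * conj (g' p.2 x)))
      (fun y => f' p.2 y * conj (g p.1 y))
  simp only [hfactor] at hsum
  rwa [integral_congr_ae ((ae_hasSum_kernel_mul_swap hK hK' c).mono fun z hz => hz.tsum_eq)]
    at hsum

end Trace

section OneParticleKernel

variable {d : ℕ}

theorem inner_oneParticle (f g : OneParticle d) :
    (inner ℂ f g : ℂ) = ∑ r, ∫ l, g r l * conj (f r l) := by
  rw [PiLp.inner_apply]
  simp only [L2.inner_def, RCLike.inner_apply]

/-- The one-particle vector with amplitude `u` in reservoir `r` and zero in the other one. -/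
noncomputable def inReservoir (r : Reservoir) (u : Lp ℂ 2 (volume : Measure (Space d))) :
    OneParticle d :=
  WithLp.toLp 2 (Pi.single r u)

theorem inner_inReservoir_left (r : Reservoir) (u : Lp ℂ 2 (volume : Measure (Space d)))
    (f : OneParticle d) : (inner ℂ (inReservoir r u) f : ℂ) = ∫ l, f r l * conj (u l) := by
  have hsingle : (inner ℂ (inReservoir r u) f : ℂ) = inner ℂ u (f r) := by
    rw [PiLp.inner_apply, Finset.sum_eq_single_of_mem r (Finset.mem_univ r) fun r' _ h => by
      simp only [inReservoir, Pi.single_eq_of_ne h, inner_zero_left]]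
    simp only [inReservoir, Pi.single_eq_same]
  rw [hsingle, L2.inner_def]
  simp only [RCLike.inner_apply]

theorem inner_inReservoir_right (r : Reservoir) (u : Lp ℂ 2 (volume : Measure (Space d)))
    (f : OneParticle d) : (inner ℂ f (inReservoir r u) : ℂ) = ∫ l, u l * conj (f r l) := by
  rw [← inner_conj_symm, inner_inReservoir_left, ← integral_conj]
  simp only [map_mul, Complex.conj_conj, mul_comm]

/-- `∑ₙ |fₙ⟩⟨gₙ|` converges in trace norm to the one-particle operator with kernel `K`, where
`K r r' (k, l)` is the amplitude from momentum `l` in reservoir `r'` to momentum `k` in `r`. -/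
structure IsKernelExpansion {ι : Type*} (f g : ι → OneParticle d) (K : Kernel d) : Prop where
  summable : Summable fun n => ‖f n‖ * ‖g n‖
  hasSum : ∀ r r', ∀ᵐ z : Space d × Space d,
    HasSum (fun n => f n r z.1 * conj (g n r' z.2)) (K r r' z)

namespace IsKernelExpansion

variable {ι κ : Type*} {f g : ι → OneParticle d} {f' g' : κ → OneParticle d} {K K' : Kernel d}

theorem summable_apply (h : IsKernelExpansion f g K) (r r' : Reservoir) :
    Summable fun n => ‖f n r‖ * ‖g n r'‖ :=
  h.summable.of_nonneg_of_le (fun n => by positivity) fun n =>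
    mul_le_mul (PiLp.norm_apply_le _ _) (PiLp.norm_apply_le _ _) (norm_nonneg _) (norm_nonneg _)

theorem adjoint (h : IsKernelExpansion f g K) :
    IsKernelExpansion g f fun r r' z => conj (K r' r z.swap) where
  summable := by simpa only [mul_comm] using h.summable
  hasSum r r' := by
    filter_upwards [Measure.measurePreserving_swap.quasiMeasurePreserving.ae (h.hasSum r' r)]
      with z hz
    refine (Complex.hasSum_conj'.2 hz).congr_fun fun n => ?_
    simp only [Prod.fst_swap, Prod.snd_swap, map_mul, Complex.conj_conj, mul_comm]

theorem hasSum_inner_mul_inner [Countable ι] (h : IsKernelExpansion f g K) (r r' : Reservoir)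
    (u v : Lp ℂ 2 (volume : Measure (Space d))) :
    HasSum (fun n => (inner ℂ (g n) (inReservoir r' u) * inner ℂ (inReservoir r v) (f n) : ℂ))
      (∫ z : Space d × Space d, K r r' z * (u z.2 * conj (v z.1))) := by
  have htrace := hasSum_trace (κ := Unit) (f' := fun _ => u) (g' := fun _ => v)
    (K' := fun z => u z.1 * conj (v z.2)) (h.summable_apply r r') Summable.of_finite
    (h.hasSum r r') (.of_forall fun z => hasSum_unique _) (c := fun _ => 1)
    aestronglyMeasurable_const zero_le_one (fun _ => norm_one.le)
  rw [← (Equiv.prodPUnit ι).symm.hasSum_iff] at htrace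
  simp only [one_mul, Function.comp_def] at htrace
  refine htrace.congr_fun fun n => ?_
  rw [inner_inReservoir_left, inner_inReservoir_right, mul_comm]
  rfl

end IsKernelExpansion

theorem continuous_eq_zero_of_setIntegral_closedBall_eq_zero {X : Type*} [PseudoMetricSpace X]
    [SecondCountableTopology X] [MeasurableSpace X] [BorelSpace X] {ν : Measure X}
    [IsLocallyFiniteMeasure ν] [IsUnifLocDoublingMeasure ν] [ν.IsOpenPosMeasure] {D : X → ℂ}
    (hD : Continuous D) (hball : ∀ x ε, ∫ y in Metric.closedBall x ε, D y ∂ν = 0) : D = 0 := by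
  refine (hD.ae_eq_iff_eq ν continuous_const).1 ?_
  filter_upwards [IsUnifLocDoublingMeasure.ae_tendsto_average ν hD.locallyIntegrable 1] with x hx
  have haverage := hx (fun _ : ℝ => x) id tendsto_id (eventually_mem_nhdsWithin.mono fun ε hε =>
    Metric.mem_closedBall_self (by simpa using (Set.mem_Ioi.1 hε).le))
  simp only [setAverage_eq, hball, smul_zero] at haverage
  exact (tendsto_nhds_unique tendsto_const_nhds haverage).symm

theorem exists_integral_mul_eq_setIntegral_closedBall (z : Space d × Space d) (ε : ℝ) :
    ∃ u v : Lp ℂ 2 (volume : Measure (Space d)), ∀ D : Space d × Space d → ℂ,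
      ∫ x : Space d × Space d, D x * (u x.2 * conj (v x.1)) =
        ∫ x in Metric.closedBall z ε, D x := by
  have hmeas (x : Space d) : MeasurableSet (Metric.closedBall x ε) :=
    Metric.isClosed_closedBall.measurableSet
  let χ (x : Space d) : Lp ℂ 2 (volume : Measure (Space d)) :=
    indicatorConstLp 2 (hmeas x) measure_closedBall_lt_top.ne 1
  have hχ (x : Space d) : χ x =ᵐ[volume] (Metric.closedBall x ε).indicator fun _ => (1 : ℂ) :=
    indicatorConstLp_coeFn
  refine ⟨χ z.2, χ z.1, fun D => ?_⟩
  rw [← integral_indicator Metric.isClosed_closedBall.measurableSet, ← closedBall_prod_same]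
  refine integral_congr_ae ?_
  filter_upwards [Measure.quasiMeasurePreserving_fst.ae (hχ z.1),
    Measure.quasiMeasurePreserving_snd.ae (hχ z.2)] with x h₁ h₂
  rw [h₁, h₂]
  by_cases hx₁ : x.1 ∈ Metric.closedBall z.1 ε <;> by_cases hx₂ : x.2 ∈ Metric.closedBall z.2 ε <;>
    simp [Set.indicator, hx₁, hx₂]

theorem continuous_eq_of_integral_mul_eq {D D' : Space d × Space d → ℂ} (hD : Continuous D)
    (hD' : Continuous D')
    (h : ∀ u v : Lp ℂ 2 (volume : Measure (Space d)),
      ∫ z : Space d × Space d, D z * (u z.2 * conj (v z.1)) =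
        ∫ z : Space d × Space d, D' z * (u z.2 * conj (v z.1))) : D = D' := by
  have hint {D : Space d × Space d → ℂ} (hD : Continuous D) (z : Space d × Space d) (ε : ℝ) :
      IntegrableOn D (Metric.closedBall z ε) :=
    hD.continuousOn.integrableOn_compact (isCompact_closedBall z ε)
  refine sub_eq_zero.1 (continuous_eq_zero_of_setIntegral_closedBall_eq_zero
    (ν := volume) (hD.sub hD') fun z ε => ?_)
  obtain ⟨u, v, huv⟩ := exists_integral_mul_eq_setIntegral_closedBall z ε
  simp only [Pi.sub_apply]
  rw [integral_sub (hint hD z ε) (hint hD' z ε), ← huv, ← huv, h, sub_self]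

end OneParticleKernel

section OneBody

variable {d : ℕ} {𝔄 : Type*} [CStarAlgebra 𝔄] {F : FieldAlgebra d 𝔄}

theorem lie_star_mul_star (f g h : OneParticle d) :
    ⁅star (F.a f) * F.a g, star (F.a h)⁆ = (inner ℂ g h : ℂ) • star (F.a f) := by
  have hanticomm : star (F.a h) * star (F.a f) = -(star (F.a f) * star (F.a h)) := by
    rw [← star_mul, ← star_mul, ← star_neg]
    exact congrArg star (eq_neg_of_add_eq_zero_left (F.anticomm f h))
  rw [Ring.lie_def, ← mul_assoc, hanticomm, mul_assoc, eq_sub_of_add_eq (F.anticomm_star g h),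
    mul_sub, mul_smul_comm, mul_one, neg_mul, mul_assoc, sub_neg_eq_add, sub_add_cancel]

theorem lie_star_mul (f g h : OneParticle d) :
    ⁅star (F.a f) * F.a g, F.a h⁆ = -((inner ℂ h f : ℂ) • F.a g) := by
  have hstar := congrArg star (lie_star_mul_star (F := F) g f h)
  simp only [Ring.lie_def, star_sub, star_mul, star_star, star_smul, RCLike.star_def,
    inner_conj_symm] at hstar
  rw [Ring.lie_def, ← hstar, neg_sub]

theorem lie_star_mul_star_mul (f g f' g' : OneParticle d) :
    ⁅star (F.a f) * F.a g, star (F.a f') * F.a g'⁆ =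
      (inner ℂ g f' : ℂ) • (star (F.a f) * F.a g') -
        (inner ℂ g' f : ℂ) • (star (F.a f') * F.a g) := by
  have hleibniz (x y z : 𝔄) : ⁅x, y * z⁆ = ⁅x, y⁆ * z + y * ⁅x, z⁆ := by
    simp only [Ring.lie_def]
    noncomm_ring
  rw [hleibniz, lie_star_mul_star, lie_star_mul, smul_mul_assoc, mul_neg, mul_smul_comm,
    sub_eq_add_neg]

/-- `X = ∑ₙ a*(fₙ) a(gₙ)` is the second quantization of the trace class one-particle operator
`∑ₙ |fₙ⟩⟨gₙ|`, whose kernel is `K`. -/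
def HasKernel (F : FieldAlgebra d 𝔄) (X : 𝔄) (K : Kernel d) : Prop :=
  ∃ f g : ℕ → OneParticle d, IsKernelExpansion f g K ∧
    HasSum (fun n => star (F.a (f n)) * F.a (g n)) X

/-- The *-homomorphism `γ` multiplies the creation operators `a*(k,r)` by `exp (i θ r |k|)`. -/
def HasPhase (F : FieldAlgebra d 𝔄) (γ : 𝔄 →⋆ₐ[ℂ] 𝔄) (θ : Reservoir → ℝ → ℝ) : Prop :=
  ∃ U : OneParticle d → OneParticle d, (∀ f, IsPhase θ f (U f)) ∧ ∀ f, γ (F.a f) = F.a (U f)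

theorem HasPhase.comp {γ γ' : 𝔄 →⋆ₐ[ℂ] 𝔄} {θ θ' : Reservoir → ℝ → ℝ} (h : HasPhase F γ θ)
    (h' : HasPhase F γ' θ') : HasPhase F (γ.comp γ') fun r κ => θ' r κ + θ r κ := by
  obtain ⟨U, hU, hγ⟩ := h
  obtain ⟨U', hU', hγ'⟩ := h'
  exact ⟨fun f => U (U' f), fun f => (hU' f).trans (hU (U' f)), fun f => by
    rw [StarAlgHom.comp_apply, hγ', hγ]⟩

theorem HasPhase.apply_eq {γ : 𝔄 →⋆ₐ[ℂ] 𝔄} {θ : Reservoir → ℝ → ℝ} (h : HasPhase F γ θ)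
    {β μ : Reservoir → ℝ} {ω : 𝔄 →L[ℂ] ℂ} (hω : IsProductEquilibrium F β μ ω) (x : 𝔄) :
    ω (γ x) = ω x := by
  obtain ⟨U, hU, hγ⟩ := h
  exact hω.apply_phase_eq hU hγ x

/-- The kernel of the one-particle operator `exp (iθ) K exp (-iθ)`. -/
noncomputable def phaseKernel (θ : Reservoir → ℝ → ℝ) (K : Kernel d) : Kernel d :=
  fun r r' z => cexp (I * (θ r ‖z.1‖ - θ r' ‖z.2‖ : ℝ)) * K r r' z

theorem IsKernelExpansion.phase {ι : Type*} [Countable ι] {f g f' g' : ι → OneParticle d}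
    {K : Kernel d} {θ : Reservoir → ℝ → ℝ} (h : IsKernelExpansion f g K)
    (hf : ∀ n, IsPhase θ (f n) (f' n)) (hg : ∀ n, IsPhase θ (g n) (g' n)) :
    IsKernelExpansion f' g' (phaseKernel θ K) where
  summable := by simpa only [(hf _).norm_eq, (hg _).norm_eq] using h.summable
  hasSum r r' := by
    filter_upwards [h.hasSum r r',
      Measure.quasiMeasurePreserving_fst.ae (ae_all_iff.2 fun n => hf n r),
      Measure.quasiMeasurePreserving_snd.ae (ae_all_iff.2 fun n => hg n r')] with z hz hfz hgz
    refine (hz.mul_left _).congr_fun fun n => ?_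
    rw [hfz, hgz, map_mul, conj_exp_I_mul, Complex.ofReal_sub, mul_sub, sub_eq_add_neg,
      Complex.exp_add, neg_mul]
    ring

theorem HasKernel.map {X : 𝔄} {K : Kernel d} {γ : 𝔄 →⋆ₐ[ℂ] 𝔄} {θ : Reservoir → ℝ → ℝ}
    (h : HasKernel F X K) (hγ : HasPhase F γ θ) : HasKernel F (γ X) (phaseKernel θ K) := by
  obtain ⟨f, g, hfg, hX⟩ := h
  obtain ⟨U, hU, hγ⟩ := hγ
  refine ⟨fun n => U (f n), fun n => U (g n), hfg.phase (fun n => hU _) (fun n => hU _), ?_⟩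
  simpa only [Function.comp_def, map_mul, map_star, hγ] using hX.map γ (continuous_starAlgHom γ)

theorem HasKernel.star {X : 𝔄} {K : Kernel d} (h : HasKernel F X K) :
    HasKernel F (star X) fun r r' z => conj (K r' r z.swap) := by
  obtain ⟨f, g, hfg, hX⟩ := h
  exact ⟨g, f, hfg.adjoint, by simpa only [star_mul, star_star] using hX.star⟩

theorem HasKernel.smul_one_eq {X : 𝔄} {K : Kernel d} (h : HasKernel F X K) (r r' : Reservoir)
    (u v : Lp ℂ 2 (volume : Measure (Space d))) :
    (∫ z : Space d × Space d, K r r' z * (u z.2 * conj (v z.1))) • (1 : 𝔄) =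
      F.a (inReservoir r v) * ⁅X, Star.star (F.a (inReservoir r' u))⁆ +
        ⁅X, Star.star (F.a (inReservoir r' u))⁆ * F.a (inReservoir r v) := by
  obtain ⟨f, g, hfg, hX⟩ := h
  have hlie : HasSum (fun n => (inner ℂ (g n) (inReservoir r' u) : ℂ) • Star.star (F.a (f n)))
      ⁅X, Star.star (F.a (inReservoir r' u))⁆ := by
    simp only [← lie_star_mul_star, Ring.lie_def]
    exact (hX.mul_right _).sub (hX.mul_left _)
  refine ((hfg.hasSum_inner_mul_inner r r' u v).smul_const 1).unique
    (((hlie.mul_left _).add (hlie.mul_right _)).congr_fun fun n => ?_)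
  rw [mul_smul_comm, smul_mul_assoc, ← smul_add, F.anticomm_star, smul_smul]

theorem HasKernel.unique [Nontrivial 𝔄] {X : 𝔄} {K K' : Kernel d} (h : HasKernel F X K)
    (h' : HasKernel F X K') (hK : ∀ r r', Continuous (K r r'))
    (hK' : ∀ r r', Continuous (K' r r')) : K = K' := by
  ext r r' : 2
  refine continuous_eq_of_integral_mul_eq (hK r r') (hK' r r') fun u v => ?_
  exact smul_left_injective ℂ (one_ne_zero (α := 𝔄))
    ((h.smul_one_eq r r' u v).trans (h'.smul_one_eq r r' u v).symm)

/-- `K` is the kernel of a self-adjoint one-particle operator. -/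
def IsHermitianKernel (K : Kernel d) : Prop :=
  ∀ r r' z, conj (K r' r z.swap) = K r r' z

theorem HasKernel.isHermitianKernel [Nontrivial 𝔄] {X : 𝔄} {K : Kernel d}
    (h : HasKernel F X K) (hX : IsSelfAdjoint X) (hK : ∀ r r', Continuous (K r r')) :
    IsHermitianKernel K := by
  have hstar := h.star
  rw [hX.star_eq] at hstar
  have heq := hstar.unique h (fun r r' => Complex.continuous_conj.comp
    ((hK r' r).comp continuous_swap)) hK
  exact fun r r' z => congrFun (congrFun (congrFun heq r) r') z

theorem IsHermitianKernel.norm_swap {K : Kernel d} (h : IsHermitianKernel K) (r r' : Reservoir)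
    (z : Space d × Space d) : ‖K r' r z.swap‖ = ‖K r r' z‖ := by
  rw [← h r r' z, RCLike.norm_conj]

end OneBody

section FermiTrace

variable {d : ℕ} {𝔄 : Type*} [CStarAlgebra 𝔄] {F : FieldAlgebra d 𝔄}

theorem continuous_fermi (β μ : Reservoir → ℝ) (r : Reservoir) :
    Continuous (fermi (d := d) β μ r) := by
  unfold fermi reducedEnergy
  exact Continuous.div (by fun_prop) (by fun_prop) fun k => by positivity

theorem fermi_nonneg (β μ : Reservoir → ℝ) (r : Reservoir) (k : Space d) : 0 ≤ fermi β μ r k := by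
  unfold fermi
  positivity

theorem fermi_le_one (β μ : Reservoir → ℝ) (r : Reservoir) (k : Space d) : fermi β μ r k ≤ 1 := by
  unfold fermi
  rw [div_le_one (by positivity)]
  exact le_add_of_nonneg_left (Real.exp_pos _).le

/-- `Tr (ρ K K')` for one-particle operators with kernels `K` and `K'`, where `ρ` is the
multiplication by the Fermi distributions. -/
noncomputable def fermiTrace (β μ : Reservoir → ℝ) (K K' : Kernel d) : ℂ :=
  ∑ r', ∑ r, ∫ z : Space d × Space d, fermi β μ r z.1 * (K r r' z * K' r' r z.swap)

theorem IsProductEquilibrium.hasSum_fermiTrace {β μ : Reservoir → ℝ} {ω : 𝔄 →L[ℂ] ℂ}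
    (hω : IsProductEquilibrium F β μ ω) {ι κ : Type*} [Countable ι] [Countable κ]
    {f g : ι → OneParticle d} {f' g' : κ → OneParticle d} {K K' : Kernel d}
    (h : IsKernelExpansion f g K) (h' : IsKernelExpansion f' g' K') :
    HasSum (fun p : ι × κ => (inner ℂ (g p.1) (f' p.2) : ℂ) *
      ω (star (F.a (f p.1)) * F.a (g' p.2))) (fermiTrace β μ K K') := by
  simp_rw [inner_oneParticle, hω.two_point, Finset.sum_mul_sum, fermiTrace]
  refine hasSum_sum fun r' _ => hasSum_sum fun r _ => ?_
  refine (hasSum_trace (h.summable_apply r r') (h'.summable_apply r' r) (h.hasSum r r')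
    (h'.hasSum r' r) (c := fun k => (fermi β μ r k : ℂ))
    (Complex.continuous_ofReal.comp (continuous_fermi β μ r)).aestronglyMeasurable zero_le_one
    fun k => ?_).congr_fun fun p => ?_
  · rw [Complex.norm_real, Real.norm_of_nonneg (fermi_nonneg β μ r k)]
    exact fermi_le_one β μ r k
  · simp only [mul_assoc]
    exact mul_comm _ _

theorem IsProductEquilibrium.apply_lie {β μ : Reservoir → ℝ} {ω : 𝔄 →L[ℂ] ℂ}
    (hω : IsProductEquilibrium F β μ ω) {X X' : 𝔄} {K K' : Kernel d} (h : HasKernel F X K)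
    (h' : HasKernel F X' K') : ω ⁅X, X'⁆ = fermiTrace β μ K K' - fermiTrace β μ K' K := by
  obtain ⟨f, g, hfg, hX⟩ := h
  obtain ⟨f', g', hfg', hX'⟩ := h'
  have hswap := (Equiv.prodComm ℕ ℕ).hasSum_iff.2 (hω.hasSum_fermiTrace hfg' hfg)
  have hlie (x : 𝔄) : HasSum (fun n => ω ⁅x, star (F.a (f' n)) * F.a (g' n)⁆) (ω ⁅x, X'⁆) := by
    simp only [Ring.lie_def]
    exact ((hX'.mul_left x).sub (hX'.mul_right x)).mapL ω
  have hlie' : HasSum (fun n => ω ⁅star (F.a (f n)) * F.a (g n), X'⁆) (ω ⁅X, X'⁆) := by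
    simp only [Ring.lie_def]
    exact ((hX.mul_right X').sub (hX.mul_left X')).mapL ω
  refine hlie'.unique (((hω.hasSum_fermiTrace hfg hfg').sub hswap).prod_fiberwise fun n => ?_)
  refine (hlie (star (F.a (f n)) * F.a (g n))).congr_fun fun m => ?_
  rw [lie_star_mul_star_mul, map_sub, map_smul, map_smul, smul_eq_mul, smul_eq_mul]
  rfl

/-- `∑_{r,r'} ∫∫ ρ_r(k) |K_{rr'}(k,l)|² exp (i (θ_r(|k|) - θ_{r'}(|l|)))`. -/
noncomputable def phaseTrace (β μ : Reservoir → ℝ) (K : Kernel d) (θ : Reservoir → ℝ → ℝ) : ℂ :=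
  ∑ r', ∑ r, ∫ z : Space d × Space d,
    cexp (I * (θ r ‖z.1‖ - θ r' ‖z.2‖ : ℝ)) * (fermi β μ r z.1 * ‖K r r' z‖ ^ 2 : ℝ)

theorem phaseTrace_neg (β μ : Reservoir → ℝ) (K : Kernel d) (θ : Reservoir → ℝ → ℝ) :
    phaseTrace β μ K (fun r κ => -θ r κ) = conj (phaseTrace β μ K θ) := by
  simp only [phaseTrace, map_sum, ← integral_conj, map_mul, Complex.conj_ofReal, conj_exp_I_mul]
  refine Finset.sum_congr rfl fun r' _ => Finset.sum_congr rfl fun r _ => ?_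
  congr 1 with z
  push_cast
  ring_nf

theorem fermiTrace_phaseKernel (β μ : Reservoir → ℝ) {K : Kernel d} (hK : IsHermitianKernel K)
    (θ η : Reservoir → ℝ → ℝ) :
    fermiTrace β μ (phaseKernel θ K) (phaseKernel η K) =
      phaseTrace β μ K fun r κ => θ r κ - η r κ := by
  simp only [fermiTrace, phaseTrace, phaseKernel]
  refine Finset.sum_congr rfl fun r' _ => Finset.sum_congr rfl fun r _ => ?_
  congr 1 with z
  have hphase : cexp (I * (θ r ‖z.1‖ - η r ‖z.1‖ - (θ r' ‖z.2‖ - η r' ‖z.2‖) : ℝ)) =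
      cexp (I * (θ r ‖z.1‖ - θ r' ‖z.2‖ : ℝ)) * cexp (I * (η r' ‖z.2‖ - η r ‖z.1‖ : ℝ)) := by
    rw [← Complex.exp_add]
    push_cast
    ring_nf
  rw [hphase, ← hK r' r z.swap, Prod.swap_swap, Complex.ofReal_mul, Complex.ofReal_pow,
    ← Complex.mul_conj', Prod.fst_swap, Prod.snd_swap]
  ring

theorem IsProductEquilibrium.apply_lie_phase {β μ : Reservoir → ℝ} {ω : 𝔄 →L[ℂ] ℂ}
    (hω : IsProductEquilibrium F β μ ω) {X : 𝔄} {K : Kernel d} (h : HasKernel F X K)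
    (hK : IsHermitianKernel K) {γ γ' : 𝔄 →⋆ₐ[ℂ] 𝔄} {θ η : Reservoir → ℝ → ℝ}
    (hγ : HasPhase F γ θ) (hγ' : HasPhase F γ' η) :
    ω ⁅γ X, γ' X⁆ = phaseTrace β μ K (fun r κ => θ r κ - η r κ) -
      conj (phaseTrace β μ K fun r κ => θ r κ - η r κ) := by
  rw [hω.apply_lie (h.map hγ) (h.map hγ'), fermiTrace_phaseKernel β μ hK,
    fermiTrace_phaseKernel β μ hK, ← phaseTrace_neg]
  simp only [neg_sub]

end FermiTrace

section Thermal

variable {d : ℕ}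

theorem isWeight_of_norm_le_gaussian {c : Space d → ℝ} (hc : Continuous c) {C b : ℝ} (hb : 0 < b)
    (h : ∀ k, ‖c k‖ ≤ C * Real.exp (-b * ‖k‖ ^ 2)) : IsWeight c where
  continuous := hc
  integrable := by
    have hgauss : Integrable fun k : Space d => Real.exp (-b * ‖k‖ ^ 2) := by
      refine (GaussianFourier.integrable_cexp_neg_mul_sq_norm_add (b := (b : ℂ))
        (by simpa using hb) 0 (0 : Space d)).norm.congr (.of_forall fun k => ?_)
      beta_reduce
      rw [zero_mul, add_zero, ← Complex.ofReal_neg, ← Complex.ofReal_pow, ← Complex.ofReal_mul,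
        Complex.norm_exp, Complex.ofReal_re]
    exact (hgauss.const_mul C).mono' hc.aestronglyMeasurable (.of_forall h)
  bounded := by
    have hC : 0 ≤ C := by simpa using (norm_nonneg _).trans (h 0)
    refine ⟨C, fun k => (h k).trans (mul_le_of_le_one_right hC (Real.exp_le_one_iff.2 ?_))⟩
    rw [neg_mul]
    exact neg_nonpos.2 (by positivity)

variable {β μ : Reservoir → ℝ}

theorem fermi_le_exp (β μ : Reservoir → ℝ) (r : Reservoir) (k : Space d) :
    fermi β μ r k ≤ Real.exp (β r * μ r) * Real.exp (-β r * ‖k‖ ^ 2) := by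
  have hexponent : β r * μ r + -β r * ‖k‖ ^ 2 = -reducedEnergy β μ r k := by
    rw [reducedEnergy]
    ring
  rw [fermi, ← Real.exp_add, hexponent, Real.exp_neg, one_div]
  gcongr
  exact le_add_of_nonneg_right zero_le_one

theorem isWeight_fermi (hβ : ∀ r, 0 < β r) (r : Reservoir) : IsWeight (fermi (d := d) β μ r) :=
  isWeight_of_norm_le_gaussian (continuous_fermi β μ r) (hβ r) fun k => by
    rw [Real.norm_of_nonneg (fermi_nonneg β μ r k)]
    exact fermi_le_exp β μ r k

theorem isWeight_norm_sq_mul_fermi (hβ : ∀ r, 0 < β r) (r : Reservoir) :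
    IsWeight fun k : Space d => ‖k‖ ^ 2 * fermi β μ r k := by
  refine isWeight_of_norm_le_gaussian (C := 2 / β r * Real.exp (β r * μ r)) (b := β r / 2)
    ((continuous_norm.pow 2).mul (continuous_fermi β μ r)) (half_pos (hβ r)) fun k => ?_
  have hβr := hβ r
  have hsq : ‖k‖ ^ 2 ≤ 2 / β r * Real.exp (β r / 2 * ‖k‖ ^ 2) := by
    calc ‖k‖ ^ 2 = 2 / β r * (β r / 2 * ‖k‖ ^ 2) := by field_simp
      _ ≤ _ := by
        gcongr
        linarith [Real.add_one_le_exp (β r / 2 * ‖k‖ ^ 2)]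
  rw [Real.norm_of_nonneg (mul_nonneg (sq_nonneg _) (fermi_nonneg β μ r k))]
  calc ‖k‖ ^ 2 * fermi β μ r k
      ≤ (2 / β r * Real.exp (β r / 2 * ‖k‖ ^ 2)) *
        (Real.exp (β r * μ r) * Real.exp (-β r * ‖k‖ ^ 2)) :=
        mul_le_mul hsq (fermi_le_exp β μ r k) (fermi_nonneg _ _ _ _) (by positivity)
    _ = 2 / β r * Real.exp (β r * μ r) *
        Real.exp (β r / 2 * ‖k‖ ^ 2 + -β r * ‖k‖ ^ 2) := by
        rw [Real.exp_add]
        ring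
    _ = _ := by
        congr 2
        ring

theorem mul_exp_sub_exp_nonneg (x y : ℝ) : 0 ≤ (x - y) * (Real.exp x - Real.exp y) := by
  rcases le_total x y with h | h
  · exact mul_nonneg_of_nonpos_of_nonpos (sub_nonpos.2 h) (sub_nonpos.2 (Real.exp_le_exp.2 h))
  · exact mul_nonneg (sub_nonneg.2 h) (sub_nonneg.2 (Real.exp_le_exp.2 h))

theorem thermalFactor_nonneg (β μ : Reservoir → ℝ) (k : Space d) : 0 ≤ thermalFactor β μ k :=
  div_nonneg (mul_exp_sub_exp_nonneg _ _) (by positivity)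

theorem thermalFactor_eq (β μ : Reservoir → ℝ) (k : Space d) :
    thermalFactor β μ k = (fermi β μ .II k - fermi β μ .I k) *
      (reducedEnergy β μ .I k - reducedEnergy β μ .II k) := by
  have hI : Real.exp (reducedEnergy β μ .I k) + 1 ≠ 0 := by positivity
  have hII : Real.exp (reducedEnergy β μ .II k) + 1 ≠ 0 := by positivity
  rw [thermalFactor, fermi, fermi]
  field_simp
  ring

theorem thermalFactor_eq_zero_iff {k : Space d} :
    thermalFactor β μ k = 0 ↔ reducedEnergy β μ .I k = reducedEnergy β μ .II k := by
  rw [thermalFactor, div_eq_zero_iff, or_iff_left (by positivity), mul_eq_zero, sub_eq_zero,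
    sub_eq_zero, Real.exp_eq_exp, or_self]

theorem reducedEnergy_eq_iff {k : Space d} :
    reducedEnergy β μ .I k = reducedEnergy β μ .II k ↔
      (β .I - β .II) * ‖k‖ ^ 2 = β .I * μ .I - β .II * μ .II := by
  rw [reducedEnergy, reducedEnergy, ← sub_eq_zero, ← sub_eq_zero (b := _ - _)]
  ring_nf

theorem thermalFactor_eq_zero (h : (β .I, μ .I) = (β .II, μ .II)) (k : Space d) :
    thermalFactor β μ k = 0 := by
  obtain ⟨hβ, hμ⟩ := Prod.mk.inj h
  rw [thermalFactor_eq_zero_iff, reducedEnergy, reducedEnergy, hβ, hμ]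

theorem ae_mul_norm_sq_ne [Nontrivial (Space d)] {x y : ℝ} (h : x ≠ 0 ∨ y ≠ 0) :
    ∀ᵐ k : Space d, x * ‖k‖ ^ 2 ≠ y := by
  filter_upwards [measure_eq_zero_iff_ae_notMem.1
    (Measure.addHaar_sphere (volume : Measure (Space d)) 0 √(y / x))] with k hk hxy
  rcases eq_or_ne x 0 with rfl | hx
  · exact h.elim (absurd rfl) fun hy => hy (by rw [← hxy, zero_mul])
  · refine hk (mem_sphere_zero_iff_norm.2 ?_)
    rw [← hxy, mul_div_cancel_left₀ _ hx, Real.sqrt_sq (norm_nonneg k)]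

theorem ae_thermalFactor_ne_zero [Nontrivial (Space d)] (hβ : ∀ r, 0 < β r)
    (h : (β .I, μ .I) ≠ (β .II, μ .II)) : ∀ᵐ k : Space d, thermalFactor β μ k ≠ 0 := by
  simp only [ne_eq, thermalFactor_eq_zero_iff, reducedEnergy_eq_iff]
  refine ae_mul_norm_sq_ne (or_iff_not_imp_left.2 fun hββ hμμ => h ?_)
  rw [not_not, sub_eq_zero] at hββ
  rw [hββ, ← mul_sub, mul_eq_zero, or_iff_right (hβ .II).ne', sub_eq_zero] at hμμ
  exact Prod.ext hββ hμμ

theorem integral_mul_thermalFactor_pos [Nontrivial (Space d)] (hβ : ∀ r, 0 < β r)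
    (h : (β .I, μ .I) ≠ (β .II, μ .II)) {S : Space d → ℝ} (hS : Continuous S)
    (hS0 : ∀ k, 0 ≤ S k) (hint : Integrable fun k => S k * thermalFactor β μ k)
    (hne : ∃ k, S k ≠ 0) : 0 < ∫ k, S k * thermalFactor β μ k := by
  rw [integral_pos_iff_support_of_nonneg
    (fun k => mul_nonneg (hS0 k) (thermalFactor_nonneg β μ k)) hint]
  refine ((isOpen_ne_fun hS continuous_const).measure_pos volume hne).trans_le
    (measure_mono_ae ?_)
  filter_upwards [ae_thermalFactor_ne_zero hβ h] with k hk hSk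
  exact mul_ne_zero hSk hk

end Thermal

section EnergyShell

variable {d : ℕ}

theorem continuous_shellIntegral {N : Space d × Space d → ℝ} (hN : Continuous N) :
    Continuous fun k : Space d => shellIntegral k fun l => N (k, l) := by
  have hsphere := continuous_parametric_integral_of_continuous
    (μ := (volume : Measure (Space d)).toSphere)
    (f := fun (k : Space d) (σ : Metric.sphere (0 : Space d) 1) => N (k, ‖k‖ • (σ : Space d)))
    (by fun_prop) isCompact_univ
  rw [Measure.restrict_univ] at hsphere
  exact ((continuous_norm.pow _).div_const 2).mul hsphere

theorem shellIntegral_nonneg (k : Space d) {h : Space d → ℝ} (hh : ∀ l, 0 ≤ h l) :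
    0 ≤ shellIntegral k h :=
  mul_nonneg (by positivity) (integral_nonneg fun _ => hh _)

theorem integral_mul_shellIntegral_swap [NeZero d] {φ : ℝ → ℝ} {N : Space d × Space d → ℝ}
    (hN : Continuous N) (h : Integrable fun k => φ ‖k‖ * shellIntegral k fun l => N (k, l))
    (h' : Integrable fun k => φ ‖k‖ * shellIntegral k fun l => N (l, k)) :
    ∫ k, φ ‖k‖ * shellIntegral k (fun l => N (k, l)) =
      ∫ k, φ ‖k‖ * shellIntegral k fun l => N (l, k) := by
  rw [integral_polar h, integral_polar h']
  refine setIntegral_congr_fun measurableSet_Ioi fun ρ hρ => ?_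
  have hnorm (σ : Metric.sphere (0 : Space d) 1) : ‖ρ • (σ : Space d)‖ = ρ := by
    rw [norm_smul, Real.norm_of_nonneg (Set.mem_Ioi.1 hρ).le, norm_eq_of_mem_sphere, mul_one]
  simp only [shellIntegral, hnorm, integral_const_mul]
  congr 3
  have hcont : Continuous (Function.uncurry fun σ τ : Metric.sphere (0 : Space d) 1 =>
      N (ρ • (σ : Space d), ρ • (τ : Space d))) := by
    fun_prop
  refine integral_integral_swap ?_
  rw [← integrableOn_univ]
  exact hcont.continuousOn.integrableOn_compact isCompact_univ

variable {c : Space d → ℝ} {M : Space d × Space d → ℝ}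

theorem HasEnergyMoments.integrable_mul_shellIntegral (hd : 3 ≤ d) (h : HasEnergyMoments c M)
    (x y : ℝ) :
    Integrable fun k => c k * ((x * ‖k‖ ^ 2 + y) * shellIntegral k fun l => M (k, l)) := by
  refine (((Tunnelling.integrable_mul_shellIntegral hd h.weight_energy h.dispersive).const_mul
    x).add ((Tunnelling.integrable_mul_shellIntegral hd h.weight h.dispersive).const_mul
    y)).congr (.of_forall fun k => ?_)
  simp only [Pi.add_apply]
  ring

end EnergyShell

section StationaryTerm

variable {d : ℕ} {𝔄 : Type*} [CStarAlgebra 𝔄]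

theorem stationaryTerm_two_two (ω : 𝔄 →L[ℂ] ℂ) (τ : ℝ → 𝔄 →⋆ₐ[ℂ] 𝔄) (W b : ℕ → 𝔄) :
    stationaryTerm ω τ W b 2 2 = I * ∫ t in Set.Ioi (0 : ℝ), ω ⁅τ (-t) (W 1), b 1⁆ := by
  have hindex : (Finset.Nat.antidiagonalTuple 2 2).filter (fun N => ∀ i, 1 ≤ N i) = {![1, 1]} := by
    decide
  have hsimplex : {t : Fin 1 → ℝ | (∀ i, 0 < t i) ∧ StrictMono t} =
      MeasurableEquiv.funUnique (Fin 1) ℝ ⁻¹' Set.Ioi 0 := by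
    ext t
    simp [Fin.forall_fin_one, Subsingleton.strictMono]
  rw [stationaryTerm, hindex, Finset.sum_singleton, pow_one, hsimplex,
    ← (volume_preserving_funUnique (Fin 1) ℝ).setIntegral_preimage_emb
      (MeasurableEquiv.measurableEmbedding _)]
  rfl

variable {F : FieldAlgebra d 𝔄} {β μ : Reservoir → ℝ} {ω : 𝔄 →L[ℂ] ℂ}

theorem IsProductEquilibrium.nontrivial (hω : IsProductEquilibrium F β μ ω) : Nontrivial 𝔄 :=
  ⟨1, 0, fun h => one_ne_zero (by rw [← hω.map_one, h, map_zero])⟩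

theorem IsProductEquilibrium.stationaryTerm_one (hω : IsProductEquilibrium F β μ ω)
    (τ : ℝ → 𝔄 →⋆ₐ[ℂ] 𝔄) (W : ℕ → 𝔄) {γ : 𝔄 →⋆ₐ[ℂ] 𝔄} {θ : Reservoir → ℝ → ℝ}
    (hγ : HasPhase F γ θ) (l : ℕ) :
    stationaryTerm ω τ W (fun N => γ (W N)) 1 l = stationaryTerm ω τ W W 1 l := by
  simp only [stationaryTerm, nestedCommutator, hγ.apply_eq hω]

theorem hasPhase_of_apply_eq_phase {γ : 𝔄 →⋆ₐ[ℂ] 𝔄} {r : Reservoir} {θ : ℝ → ℝ}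
    (hθ : Continuous θ) (h : ∀ f, γ (F.a f) = F.a (phase r θ hθ f)) :
    HasPhase F γ fun r' κ => if r' = r then θ κ else 0 :=
  ⟨phase r θ hθ, isPhase_phase r hθ, h⟩

theorem IsFreeEvolution.hasPhase_freeEvolution {α : Reservoir → ℝ → 𝔄 →⋆ₐ[ℂ] 𝔄}
    (hα : IsFreeEvolution F α) (t : ℝ) : HasPhase F (freeEvolution α t) fun _ κ => t * κ ^ 2 := by
  have hcomp : HasPhase F (freeEvolution α t) _ :=
    (hasPhase_of_apply_eq_phase _ (hα .I t)).comp (hasPhase_of_apply_eq_phase _ (hα .II t))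
  convert hcomp using 3 with r κ
  cases r <;> simp

/-- The flow `γ` generated by the one-particle energies `a_r |k|² + b_r`: it multiplies the creation
operators `a*(k,r)` by `exp (i s (a_r |k|² + b_r))`. -/
def IsQuadraticFlow (F : FieldAlgebra d 𝔄) (γ : ℝ → 𝔄 →⋆ₐ[ℂ] 𝔄) (a b : Reservoir → ℝ) : Prop :=
  ∀ s, HasPhase F (γ s) fun r κ => s * (a r * κ ^ 2 + b r)

theorem IsFreeEvolution.isQuadraticFlow {α : Reservoir → ℝ → 𝔄 →⋆ₐ[ℂ] 𝔄}
    (hα : IsFreeEvolution F α) (r : Reservoir) : IsQuadraticFlow F (α r) (Pi.single r 1) 0 := by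
  intro s
  convert hasPhase_of_apply_eq_phase _ (hα r s) using 3 with r' κ
  simp [Pi.single_apply]

theorem IsGauge.isQuadraticFlow {φ : Reservoir → ℝ → 𝔄 →⋆ₐ[ℂ] 𝔄} (hφ : IsGauge F φ)
    (r : Reservoir) : IsQuadraticFlow F (φ r) 0 (Pi.single r 1) := by
  intro s
  convert hasPhase_of_apply_eq_phase _ (hφ r s) using 3 with r' κ
  simp [Pi.single_apply]

theorem exists_isQuadraticFlow {α φ : Reservoir → ℝ → 𝔄 →⋆ₐ[ℂ] 𝔄} (hα : IsFreeEvolution F α)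
    (hφ : IsGauge F φ) {γ : ℝ → 𝔄 →⋆ₐ[ℂ] 𝔄} (hγ : γ ∈ ({α .I, α .II, φ .I, φ .II} : Set _)) :
    ∃ a b, IsQuadraticFlow F γ a b := by
  rcases hγ with rfl | rfl | rfl | rfl
  exacts [⟨_, _, hα.isQuadraticFlow .I⟩, ⟨_, _, hα.isQuadraticFlow .II⟩,
    ⟨_, _, hφ.isQuadraticFlow .I⟩, ⟨_, _, hφ.isQuadraticFlow .II⟩]

theorem IsProductEquilibrium.currentTerm_one (hω : IsProductEquilibrium F β μ ω)
    (τ : ℝ → 𝔄 →⋆ₐ[ℂ] 𝔄) (W : ℕ → 𝔄) {γ : ℝ → 𝔄 →⋆ₐ[ℂ] 𝔄} {a b : Reservoir → ℝ}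
    (hγ : IsQuadraticFlow F γ a b) (l : ℕ) : currentTerm ω τ W γ 1 l = 0 := by
  simp only [currentTerm, hω.stationaryTerm_one τ W (hγ _) l, deriv_const, neg_zero]

end StationaryTerm

section Current

variable {d : ℕ} {β μ : Reservoir → ℝ} {K : Kernel d}

theorem sum_reservoir {G : Type*} [AddCommMonoid G] (f : Reservoir → G) :
    ∑ r, f r = f .I + f .II :=
  Finset.sum_pair (by decide)

/-- The kernels of the self-adjoint one-particle operators for which the currents of order two
are defined. -/
structure IsAdmissibleKernel (β μ : Reservoir → ℝ) (K : Kernel d) : Prop where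
  hermitian : IsHermitianKernel K
  moments : ∀ p r r', HasEnergyMoments (fermi β μ p) fun z => ‖K r r' z‖ ^ 2

/-- The contribution of a pair of reservoirs to `ω([W(t), γ_s(W)])`, summed over all pairs; the
other half of the commutator is its complex conjugate. -/
noncomputable def totalCorrelation (β μ : Reservoir → ℝ) (K : Kernel d) (a b : Reservoir → ℝ)
    (t s : ℝ) : ℂ :=
  ∑ r', ∑ r, correlation (fermi β μ r) (fun z => ‖K r r' z‖ ^ 2) (a r) (a r') (b r) (b r') t s

theorem phaseTrace_eq_totalCorrelation (β μ : Reservoir → ℝ) (K : Kernel d)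
    (a b : Reservoir → ℝ) (t s : ℝ) :
    phaseTrace β μ K (fun r κ => -t * κ ^ 2 - s * (a r * κ ^ 2 + b r)) =
      totalCorrelation β μ K a b t s := by
  refine Finset.sum_congr rfl fun r' _ => Finset.sum_congr rfl fun r _ => ?_
  rw [correlation, oscillation, ← integral_const_mul]
  congr 1 with z
  rw [← mul_assoc, ← Complex.exp_add]
  congr 2
  push_cast
  ring

theorem integrable_totalCorrelation (hd : 3 ≤ d) (h : IsAdmissibleKernel β μ K)
    (a b : Reservoir → ℝ) (s : ℝ) : Integrable fun t => totalCorrelation β μ K a b t s :=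
  integrable_finsetSum _ fun r' _ => integrable_finsetSum _ fun r _ =>
    integrable_correlation hd (h.moments r r r') _ _ _ _ s

theorem integrable_conj {X : Type*} [MeasurableSpace X] {ν : Measure X} {f : X → ℂ}
    (hf : Integrable f ν) : Integrable (fun x => conj (f x)) ν :=
  Complex.conjCLE.toContinuousLinearMap.integrable_comp hf

/-- The integral over all positive times of `totalCorrelation`. -/
noncomputable def dysonIntegral (β μ : Reservoir → ℝ) (K : Kernel d) (a b : Reservoir → ℝ)
    (s : ℝ) : ℂ :=
  ∫ t in Set.Ioi 0, totalCorrelation β μ K a b t s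

theorem integral_sub_conj_totalCorrelation (hd : 3 ≤ d) (h : IsAdmissibleKernel β μ K)
    (a b : Reservoir → ℝ) (s : ℝ) :
    ∫ t in Set.Ioi 0, (totalCorrelation β μ K a b t s - conj (totalCorrelation β μ K a b t s)) =
      dysonIntegral β μ K a b s - conj (dysonIntegral β μ K a b s) := by
  have hint := (integrable_totalCorrelation hd h a b s).integrableOn (s := Set.Ioi 0)
  rw [integral_sub hint (integrable_conj hint), integral_conj, dysonIntegral]

/-- `-i` times the derivative of `dysonIntegral` at `s = 0`. -/
noncomputable def dysonIntegralDeriv (β μ : Reservoir → ℝ) (K : Kernel d)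
    (a b : Reservoir → ℝ) : ℂ :=
  ∑ r', ∑ r, ∫ t in Set.Ioi 0,
    correlationDeriv (fermi β μ r) (fun z => ‖K r r' z‖ ^ 2) (a r) (a r') (b r) (b r') t 0

theorem hasDerivAt_dysonIntegral (hd : 3 ≤ d) (h : IsAdmissibleKernel β μ K)
    (a b : Reservoir → ℝ) :
    HasDerivAt (dysonIntegral β μ K a b) (I * dysonIntegralDeriv β μ K a b) 0 := by
  have hint (s : ℝ) (r r' : Reservoir) :=
    (integrable_correlation hd (h.moments r r r') (a r) (a r') (b r) (b r') s).integrableOn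
      (s := Set.Ioi 0)
  have hsum : dysonIntegral β μ K a b = fun s => ∑ r', ∑ r, ∫ t in Set.Ioi 0,
      correlation (fermi β μ r) (fun z => ‖K r r' z‖ ^ 2) (a r) (a r') (b r) (b r') t s := by
    ext s
    simp only [dysonIntegral, totalCorrelation]
    rw [integral_finsetSum _ fun r' _ => integrable_finsetSum _ fun r _ => hint s r r']
    exact Finset.sum_congr rfl fun r' _ => integral_finsetSum _ fun r _ => hint s r r'
  simp only [hsum, dysonIntegralDeriv, Finset.mul_sum]
  exact .fun_sum fun r' _ => .fun_sum fun r _ =>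
    hasDerivAt_integral_correlation hd (h.moments r r r') _ _ _ _

/-- The rate of transitions between the reservoirs on the energy shell of the momentum `k`. -/
noncomputable def tunnellingWeight (K : Kernel d) (k : Space d) : ℝ :=
  shellIntegral k fun l => ‖K .II .I (k, l)‖ ^ 2

/-- The current of the charge with one-particle energies `a_r |k|² + b_r` as predicted by Fermi's
golden rule, where `x = a_I - a_II` and `y = b_I - b_II`. -/
noncomputable def goldenRuleCurrent (β μ : Reservoir → ℝ) (K : Kernel d) (x y : ℝ) : ℝ :=
  2 * π * ∫ k, (fermi β μ .II k - fermi β μ .I k) * ((x * ‖k‖ ^ 2 + y) * tunnellingWeight K k)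

theorem IsAdmissibleKernel.integrable_tunnellingWeight (hd : 3 ≤ d) (h : IsAdmissibleKernel β μ K)
    (r : Reservoir) (x y : ℝ) :
    Integrable fun k => fermi β μ r k * ((x * ‖k‖ ^ 2 + y) * tunnellingWeight K k) :=
  (h.moments r .II .I).integrable_mul_shellIntegral hd x y

theorem IsAdmissibleKernel.integrable_goldenRule (hd : 3 ≤ d) (h : IsAdmissibleKernel β μ K)
    (x y : ℝ) : Integrable fun k =>
      (fermi β μ .II k - fermi β μ .I k) * ((x * ‖k‖ ^ 2 + y) * tunnellingWeight K k) := by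
  simp only [sub_mul]
  exact (h.integrable_tunnellingWeight hd .II x y).sub (h.integrable_tunnellingWeight hd .I x y)

theorem IsAdmissibleKernel.integral_fermi_mul_shellIntegral_swap (hd : 3 ≤ d)
    (h : IsAdmissibleKernel β μ K) (x y : ℝ) :
    ∫ k, fermi β μ .I k *
      ((x * ‖k‖ ^ 2 + y) * shellIntegral k fun l => ‖K .I .II (k, l)‖ ^ 2) =
      ∫ k, fermi β μ .I k * ((x * ‖k‖ ^ 2 + y) * tunnellingWeight K k) := by
  have : NeZero d := ⟨by omega⟩
  have hswap (k l : Space d) : ‖K .II .I (k, l)‖ = ‖K .I .II (l, k)‖ :=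
    h.hermitian.norm_swap .I .II (l, k)
  have hint := (h.moments .I .I .II).integrable_mul_shellIntegral hd x y
  have hint' := h.integrable_tunnellingWeight hd .I x y
  simp only [tunnellingWeight, hswap, ← mul_assoc] at hint hint' ⊢
  exact integral_mul_shellIntegral_swap
    (φ := fun κ => 1 / (Real.exp (β .I * (κ ^ 2 - μ .I)) + 1) * (x * κ ^ 2 + y))
    (h.moments .I .I .II).dispersive.continuous hint hint'

theorem IsAdmissibleKernel.goldenRuleCurrent_eq (hd : 3 ≤ d) (h : IsAdmissibleKernel β μ K)
    (x y : ℝ) :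
    goldenRuleCurrent β μ K x y = 2 * π *
      ((∫ k, fermi β μ .II k * ((x * ‖k‖ ^ 2 + y) * tunnellingWeight K k)) +
        ∫ k, fermi β μ .I k * ((-x * ‖k‖ ^ 2 + -y) * tunnellingWeight K k)) := by
  rw [goldenRuleCurrent, ← integral_add (h.integrable_tunnellingWeight hd .II x y)
    (h.integrable_tunnellingWeight hd .I (-x) (-y))]
  congr 2 with k
  ring

/-- The two halves of the commutator extend the time integral to the whole line, which then yields
the energy conserving delta function. -/
theorem IsAdmissibleKernel.dysonIntegralDeriv_add_conj (hd : 3 ≤ d) (h : IsAdmissibleKernel β μ K)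
    (a b : Reservoir → ℝ) :
    dysonIntegralDeriv β μ K a b + conj (dysonIntegralDeriv β μ K a b) =
      goldenRuleCurrent β μ K (a .I - a .II) (b .I - b .II) := by
  simp only [dysonIntegralDeriv, map_sum, ← Finset.sum_add_distrib]
  simp only [integral_Ioi_correlationDeriv_add_conj hd (h.moments _ _ _),
    integral_correlationDeriv hd (h.moments _ _ _)]
  simp only [sum_reservoir, sub_self, zero_mul, add_zero, mul_zero, integral_zero,
    Complex.ofReal_zero, zero_add]
  rw [h.integral_fermi_mul_shellIntegral_swap hd, h.goldenRuleCurrent_eq hd, neg_sub, neg_sub]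
  push_cast [tunnellingWeight]
  ring

variable {𝔄 : Type*} [CStarAlgebra 𝔄] {F : FieldAlgebra d 𝔄} {ω : 𝔄 →L[ℂ] ℂ}
  {α : Reservoir → ℝ → 𝔄 →⋆ₐ[ℂ] 𝔄} {γ : ℝ → 𝔄 →⋆ₐ[ℂ] 𝔄} {a b : Reservoir → ℝ}

theorem IsProductEquilibrium.apply_lie_flow (hω : IsProductEquilibrium F β μ ω)
    (hα : IsFreeEvolution F α) {X : 𝔄} (hX : HasKernel F X K) (hK : IsHermitianKernel K)
    (hγ : IsQuadraticFlow F γ a b) (t s : ℝ) :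
    ω ⁅freeEvolution α (-t) X, γ s X⁆ =
      totalCorrelation β μ K a b t s - conj (totalCorrelation β μ K a b t s) := by
  rw [hω.apply_lie_phase hX hK (hα.hasPhase_freeEvolution (-t)) (hγ s),
    phaseTrace_eq_totalCorrelation]

theorem IsProductEquilibrium.integrable_apply_lie (hd : 3 ≤ d) (hω : IsProductEquilibrium F β μ ω)
    (hα : IsFreeEvolution F α) {X : 𝔄} (hX : HasKernel F X K) (hK : IsAdmissibleKernel β μ K)
    (hγ : IsQuadraticFlow F γ a b) (s : ℝ) :
    Integrable fun t => ω ⁅freeEvolution α (-t) X, γ s X⁆ := by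
  have hint := integrable_totalCorrelation hd hK a b s
  simp only [hω.apply_lie_flow hα hX hK.hermitian hγ]
  exact hint.sub (integrable_conj hint)

theorem IsProductEquilibrium.hasDerivAt_stationaryTerm (hd : 3 ≤ d)
    (hω : IsProductEquilibrium F β μ ω) (hα : IsFreeEvolution F α) {W : ℕ → 𝔄}
    (hW : HasKernel F (W 1) K) (hK : IsAdmissibleKernel β μ K) (hγ : IsQuadraticFlow F γ a b) :
    HasDerivAt (fun s : ℝ => stationaryTerm ω (freeEvolution α) W (fun N => γ s (W N)) 2 2)
      (-(goldenRuleCurrent β μ K (a .I - a .II) (b .I - b .II) : ℂ)) 0 := by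
  simp only [stationaryTerm_two_two, hω.apply_lie_flow hα hW hK.hermitian hγ,
    integral_sub_conj_totalCorrelation hd hK]
  have hderiv := hasDerivAt_dysonIntegral hd hK a b
  refine ((hderiv.sub hderiv.star).const_mul I).congr_deriv ?_
  rw [← hK.dysonIntegralDeriv_add_conj hd, star_mul', RCLike.star_def, Complex.conj_I]
  linear_combination
    (dysonIntegralDeriv β μ K a b + conj (dysonIntegralDeriv β μ K a b)) * Complex.I_sq

theorem IsProductEquilibrium.currentTerm_two_two (hd : 3 ≤ d) (hω : IsProductEquilibrium F β μ ω)
    (hα : IsFreeEvolution F α) {W : ℕ → 𝔄} (hW : HasKernel F (W 1) K)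
    (hK : IsAdmissibleKernel β μ K) (hγ : IsQuadraticFlow F γ a b) :
    currentTerm ω (freeEvolution α) W γ 2 2 =
      goldenRuleCurrent β μ K (a .I - a .II) (b .I - b .II) := by
  rw [currentTerm, (hω.hasDerivAt_stationaryTerm hd hα hW hK hγ).deriv, neg_neg]

end Current

section EntropyProduction

variable {d : ℕ} {β μ : Reservoir → ℝ} {K : Kernel d}

theorem IsAdmissibleKernel.goldenRuleCurrent_linear (hd : 3 ≤ d) (h : IsAdmissibleKernel β μ K)
    (x y : ℝ) : goldenRuleCurrent β μ K x y =
      x * goldenRuleCurrent β μ K 1 0 + y * goldenRuleCurrent β μ K 0 1 := by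
  simp only [goldenRuleCurrent, mul_left_comm _ (2 * π)]
  rw [← mul_add, ← integral_const_mul x, ← integral_const_mul y, ← integral_add
    ((h.integrable_goldenRule hd 1 0).const_mul x) ((h.integrable_goldenRule hd 0 1).const_mul y)]
  congr 2 with k
  ring

theorem tunnellingWeight_mul_thermalFactor (β μ : Reservoir → ℝ) (K : Kernel d) (k : Space d) :
    tunnellingWeight K k * thermalFactor β μ k = (fermi β μ .II k - fermi β μ .I k) *
      (((β .I - β .II) * ‖k‖ ^ 2 + -(β .I * μ .I - β .II * μ .II)) * tunnellingWeight K k) := by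
  rw [thermalFactor_eq, reducedEnergy, reducedEnergy]
  ring

theorem IsAdmissibleKernel.integrable_tunnellingWeight_mul_thermalFactor (hd : 3 ≤ d)
    (h : IsAdmissibleKernel β μ K) :
    Integrable fun k => tunnellingWeight K k * thermalFactor β μ k := by
  simp only [tunnellingWeight_mul_thermalFactor]
  exact h.integrable_goldenRule hd _ _

variable {𝔄 : Type*} [CStarAlgebra 𝔄] {F : FieldAlgebra d 𝔄} {ω : 𝔄 →L[ℂ] ℂ}
  {α φ : Reservoir → ℝ → 𝔄 →⋆ₐ[ℂ] 𝔄} {W : ℕ → 𝔄}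

theorem IsProductEquilibrium.entropyProduction_one (hω : IsProductEquilibrium F β μ ω)
    (hα : IsFreeEvolution F α) (hφ : IsGauge F φ) (W : ℕ → 𝔄) (l : ℕ) :
    entropyProduction β μ ω α φ W 1 l = 0 := by
  simp only [entropyProduction, energyCurrent, particleCurrent,
    hω.currentTerm_one _ W (hα.isQuadraticFlow _), hω.currentTerm_one _ W (hφ.isQuadraticFlow _),
    mul_zero, sub_zero, Finset.sum_const_zero]

theorem IsProductEquilibrium.entropyProduction_two_two_eq_currents (hd : 3 ≤ d)
    (hω : IsProductEquilibrium F β μ ω) (hα : IsFreeEvolution F α) (hφ : IsGauge F φ)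
    (hW : HasKernel F (W 1) K) (hK : IsAdmissibleKernel β μ K) :
    entropyProduction β μ ω α φ W 2 2 =
      ((β .I - β .II : ℝ) : ℂ) * energyCurrent ω α W .I 2 2 -
        ((β .I * μ .I - β .II * μ .II : ℝ) : ℂ) * particleCurrent ω α φ W .I 2 2 := by
  have henergy (r : Reservoir) := hω.currentTerm_two_two hd hα hW hK (hα.isQuadraticFlow r)
  have hparticle (r : Reservoir) := hω.currentTerm_two_two hd hα hW hK (hφ.isQuadraticFlow r)
  have hlinear := hK.goldenRuleCurrent_linear hd
  simp only [entropyProduction, energyCurrent, particleCurrent, sum_reservoir, henergy, hparticle,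
    hlinear (_ - _), Pi.single_apply, Pi.zero_apply, reduceCtorEq, if_true, if_false]
  push_cast
  ring

theorem IsProductEquilibrium.entropyProduction_two_two (hd : 3 ≤ d)
    (hω : IsProductEquilibrium F β μ ω) (hα : IsFreeEvolution F α) (hφ : IsGauge F φ)
    (hW : HasKernel F (W 1) K) (hK : IsAdmissibleKernel β μ K) :
    entropyProduction β μ ω α φ W 2 2 =
      (2 * π * ∫ k, tunnellingWeight K k * thermalFactor β μ k : ℝ) := by
  have henergy := hω.currentTerm_two_two hd hα hW hK (hα.isQuadraticFlow .I)
  have hparticle := hω.currentTerm_two_two hd hα hW hK (hφ.isQuadraticFlow .I)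
  have hsplit := hK.goldenRuleCurrent_linear hd (β .I - β .II) (-(β .I * μ .I - β .II * μ .II))
  simp only [Pi.single_apply, Pi.zero_apply, reduceCtorEq, if_true, if_false, sub_zero]
    at henergy hparticle
  simp only [tunnellingWeight_mul_thermalFactor]
  rw [← goldenRuleCurrent, hsplit, hω.entropyProduction_two_two_eq_currents hd hα hφ hW hK,
    energyCurrent, particleCurrent, henergy, hparticle]
  push_cast
  ring

end EntropyProduction

section MomentumKernel

variable {d : ℕ} {w : Kernel d}

/-- The kernel `ŵ₁((-k,r),(l,r'))` of the one-particle operator in momentum representation. -/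
noncomputable def momentumKernel (w : Kernel d) : Kernel d := fun r r' z =>
  kernelFourier w r r' (-z.1) z.2

theorem continuous_momentumKernel (hw : IsRegularKernel w) (r r' : Reservoir) :
    Continuous (momentumKernel w r r') := by
  have hneg : Continuous fun z : Space d × Space d => (-z.1, z.2) := by fun_prop
  exact ((continuous_doubleFourier (memLp_one_iff_integrable.1 (hw r r').1)).comp hneg :)

theorem continuous_onShellWeight (hw : IsRegularKernel w) : Continuous (onShellWeight w) :=
  continuous_shellIntegral ((continuous_momentumKernel hw .II .I).norm.pow 2)

theorem tunnellingWeight_momentumKernel (w : Kernel d) :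
    tunnellingWeight (momentumKernel w) = onShellWeight w :=
  rfl

theorem onShellWeight_nonneg (w : Kernel d) (k : Space d) : 0 ≤ onShellWeight w k :=
  shellIntegral_nonneg k fun _ => by positivity

theorem shellIntegral_mul_thermalFactor (β μ : Reservoir → ℝ) (w : Kernel d) (k : Space d) :
    (shellIntegral k fun l => ‖kernelFourier w .II .I (-k) l‖ ^ 2 * thermalFactor β μ k) =
      onShellWeight w k * thermalFactor β μ k := by
  simp only [mul_comm _ (thermalFactor β μ k)]
  exact shellIntegral_mul_left k (fun _ => thermalFactor β μ k) _

variable {𝔄 : Type*} [CStarAlgebra 𝔄] {F : FieldAlgebra d 𝔄}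

theorem IsOneBodyInteraction.hasKernel {X : 𝔄} (h : IsOneBodyInteraction F w X) :
    HasKernel F X (momentumKernel w) := by
  obtain ⟨f, g, hfg, hK, hX⟩ := h
  exact ⟨f, g, ⟨hfg, hK⟩, hX⟩

theorem isAdmissibleKernel_momentumKernel [Nontrivial 𝔄] {β : Reservoir → ℝ} (hβ : ∀ r, 0 < β r)
    (μ : Reservoir → ℝ) (hw : IsRegularKernel w) {X : 𝔄} (hX : HasKernel F X (momentumKernel w))
    (hsa : IsSelfAdjoint X) : IsAdmissibleKernel β μ (momentumKernel w) where
  hermitian := hX.isHermitianKernel hsa (continuous_momentumKernel hw)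
  moments p r r' :=
    { weight := isWeight_fermi hβ p
      weight_energy := isWeight_norm_sq_mul_fermi hβ p
      dispersive := isDispersive_kernel hw r r'
      dispersive_energy := isDispersive_norm_sq_mul_kernel hw r r' }

end MomentumKernel

end Tunnelling

open Tunnelling Tunnelling.Reservoir in
theorem mainTheorem4 {d : ℕ} (hd : 3 ≤ d) {𝔄 : Type*} [CStarAlgebra 𝔄] (F : FieldAlgebra d 𝔄)
    (α φ : Reservoir → ℝ → 𝔄 →⋆ₐ[ℂ] 𝔄) (hα : IsFreeEvolution F α) (hφ : IsGauge F φ)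
    (β μ : Reservoir → ℝ) (hβ : ∀ r, 0 < β r)
    (ω : 𝔄 →L[ℂ] ℂ) (hω : IsProductEquilibrium F β μ ω)
    (w : Kernel d) (hw : IsRegularKernel w)
    (W : ℕ → 𝔄) (hW : IsOneBodyInteraction F w (W 1)) (hsa : IsSelfAdjoint (W 1)) :
    -- the terms of order g²ξ² of the currents are well defined
    (∀ γ ∈ ({α I, α II, φ I, φ II} : Set (ℝ → 𝔄 →⋆ₐ[ℂ] 𝔄)),
      (∀ s, IntegrableOn (fun t => ω ⁅freeEvolution α (-t) (W 1), γ s (W 1)⁆) (Set.Ioi 0)) ∧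
      DifferentiableAt ℝ
        (fun s : ℝ => stationaryTerm ω (freeEvolution α) W (fun N => γ s (W N)) 2 2) 0) ∧
    -- the terms of lower order of the entropy production rate vanish
    entropyProduction β μ ω α φ W 1 1 = 0 ∧ entropyProduction β μ ω α φ W 1 2 = 0 ∧
    -- the leading term in terms of the currents
    entropyProduction β μ ω α φ W 2 2 =
      ((β I - β II : ℝ) : ℂ) * energyCurrent ω α W I 2 2 -
        ((β I * μ I - β II * μ II : ℝ) : ℂ) * particleCurrent ω α φ W I 2 2 ∧
    -- the leading term as an integral, with a non-negative thermal factor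
    Integrable (fun k : Space d => shellIntegral k fun l =>
      ‖kernelFourier w II I (-k) l‖ ^ 2 * thermalFactor β μ k) ∧
    entropyProduction β μ ω α φ W 2 2 =
      ((2 * Real.pi * ∫ k : Space d, shellIntegral k fun l =>
        ‖kernelFourier w II I (-k) l‖ ^ 2 * thermalFactor β μ k : ℝ) : ℂ) ∧
    (∀ k : Space d, 0 ≤ thermalFactor β μ k) ∧
    -- strict positivity
    ((∃ k : Space d, onShellWeight w k ≠ 0) → (β I, μ I) ≠ (β II, μ II) →
      0 < (entropyProduction β μ ω α φ W 2 2).re) ∧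
    ((β I, μ I) = (β II, μ II) → entropyProduction β μ ω α φ W 2 2 = 0) := by
  have := hω.nontrivial
  have : NeZero d := ⟨by omega⟩
  have hker := hW.hasKernel
  have hK := isAdmissibleKernel_momentumKernel hβ μ hw hker hsa
  have hint := hK.integrable_tunnellingWeight_mul_thermalFactor hd
  have hE := hω.entropyProduction_two_two hd hα hφ hker hK
  simp only [tunnellingWeight_momentumKernel] at hint hE
  simp only [shellIntegral_mul_thermalFactor]
  refine ⟨fun γ hγ => ?_, hω.entropyProduction_one hα hφ W 1, hω.entropyProduction_one hα hφ W 2,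
    hω.entropyProduction_two_two_eq_currents hd hα hφ hker hK, hint, hE, thermalFactor_nonneg β μ,
    fun hne h => ?_, fun h => ?_⟩
  · obtain ⟨a, b, hγ⟩ := exists_isQuadraticFlow hα hφ hγ
    exact ⟨fun s => (hω.integrable_apply_lie hd hα hker hK hγ s).integrableOn,
      (hω.hasDerivAt_stationaryTerm hd hα hker hK hγ).differentiableAt⟩
  · rw [hE, Complex.ofReal_re]
    exact mul_pos Real.two_pi_pos (integral_mul_thermalFactor_pos hβ h
      (continuous_onShellWeight hw) (onShellWeight_nonneg w) hint hne)
  · simp only [hE, thermalFactor_eq_zero h, mul_zero, integral_zero, Complex.ofReal_zero]
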